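/- Let $n\ge 1$, let $\Omega_1,\Omega_2\subset\mathbb R^n$ be open, and let $f:\Omega_1\to\Omega_2$ be a homeomorphism of $\Omega_1$ onto $\Omega_2$ with $f\in W^{1,1}_{\mathrm{loc}}(\Omega_1,\mathbb R^n)$. Let $Df$ denote its weak derivative, $J_f=\det Df$, and let $|\cdot|$ be the Euclidean (Frobenius) norm on $n\times n$ matrices. For open $G\subset\Omega_1$ put $$|Df|(G)=\sup\Big\{\sum_{i=1}^n\int_G f_i\,\operatorname{div}\varphi_i\,dx:\ \varphi\in C^1_c(G,\mathbb R^{n\times n}),\ |\varphi(x)|\le 1 \text{ for all } x\Big\}\in[0,\infty],$$ and for a Borel set $E\subset\Omega_1$ let $|Df|(E)=\inf\{|Df|(G): G \text{ open},\ E\subset G\subset\Omega_1\}$ be the total variation measure of the distributional derivative. Let $1\le q<\infty$ and $\frac1q+\frac1{q'}=1$ (so $q'=\infty$ if $q=1$). Then the following are equivalent: (i) there is a nonnegative function $K\in L^{q'}(\Omega_2)$ such that $$|Df|\big(f^{-1}(A)\big)\le\int_A K(y)\,dy\quad\text{for all Borel sets } A\subset\Omega_2;$$ (ii) there is a function $L\in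 L^{q'}(\Omega_1)$ such that $$|Df(x)|\le L(x)\,|J_f(x)|^{1/q}\quad\text{for a.e. } x\in\Omega_1.$$ -/

import Mathlib

open MeasureTheory Set
open scoped ENNReal ContDiff Matrix.Norms.Frobenius

/-- `ℝⁿ` with the Euclidean norm. -/
abbrev Rn (n : ℕ) : Type := EuclideanSpace ℝ (Fin n)

/-- The classical partial derivative `∂ψ/∂xⱼ` at `x`. -/
noncomputable def partialDeriv {n : ℕ} (j : Fin n) (ψ : Rn n → ℝ) (x : Rn n) : ℝ :=
  fderiv ℝ ψ x (EuclideanSpace.single j 1)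

/-- `u` belongs to `W^{1,1}_loc(Ω, ℝᵈ)` and the matrix field `Du` represents its distributional
derivative on the open set `Ω`: the entry `(i, j)` is the weak derivative `∂uᵢ/∂xⱼ`, tested
against `C_c^∞(Ω)`. -/
structure HasLocSobolevDeriv {n d : ℕ} (Ω : Set (Rn n)) (u : Rn n → Rn d)
    (Du : Rn n → Matrix (Fin d) (Fin n) ℝ) : Prop where
  locallyIntegrableOn : LocallyIntegrableOn u Ω volume
  locallyIntegrableOn_deriv : ∀ i j, LocallyIntegrableOn (fun x => Du x i j) Ω volume
  integral_mul_partialDeriv : ∀ (i : Fin d) (j : Fin n) (φ : Rn n → ℝ),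
    ContDiff ℝ ∞ φ → HasCompactSupport φ → tsupport φ ⊆ Ω →
      ∫ x in Ω, u x i * partialDeriv j φ x = - ∫ x in Ω, Du x i j * φ x

/-- `φ ∈ C_c^1(G, ℝ^{d×n})` with `|φ(x)| ≤ 1` everywhere, `|·|` being the Euclidean (Frobenius)
norm of matrices. -/
structure IsTestField {n d : ℕ} (G : Set (Rn n)) (φ : Rn n → Matrix (Fin d) (Fin n) ℝ) :
    Prop where
  contDiff : ∀ i j, ContDiff ℝ 1 (fun x => φ x i j)
  hasCompactSupport : HasCompactSupport φ
  tsupport_subset : tsupport φ ⊆ G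
  norm_le_one : ∀ x, ‖φ x‖ ≤ 1

/-- The total variation of the distributional derivative on an open set `G`:
`sup ∑ᵢ ∫_G uᵢ div φᵢ` over all test fields `φ` in `G`. -/
noncomputable def openVariation {n d : ℕ} (u : Rn n → Rn d) (G : Set (Rn n)) : ℝ≥0∞ :=
  ⨆ (φ : Rn n → Matrix (Fin d) (Fin n) ℝ) (_ : IsTestField G φ),
    ENNReal.ofReal
      (∑ i, ∫ x in G, u x i * ∑ j, partialDeriv j (fun y => φ y i j) x)

/-- The total variation measure `|Du|` on (Borel) subsets `E` of the open set `Ω`: the outer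
regular extension of its values on open sets. -/
noncomputable def totalVariation {n d : ℕ} (Ω : Set (Rn n)) (u : Rn n → Rn d)
    (E : Set (Rn n)) : ℝ≥0∞ :=
  ⨅ (G : Set (Rn n)) (_ : IsOpen G) (_ : E ⊆ G) (_ : G ⊆ Ω), openVariation u G

/-!
By duality, `|Df|(E) = ∫_E |Df|` whenever the distributional derivative is a locally integrable
matrix field. The weak type `(1, 1)` bound for the local maximal function, applied to the
mollifications of `f`, shows that a Sobolev map is differentiable along each of countably many
measurable sets which cover almost all of its domain, so an injective one satisfies the area
formula away from a null set. Hence (i) says exactly that `|Df| ≤ |J_f| · (K ∘ f)` almost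
everywhere. Put `L = |J_f| ^ (1 / q') · (K ∘ f)`: then `|J_f| · (K ∘ f) = L · |J_f| ^ (1 / q)`, and
the change of variables `y = f x` on `{J_f ≠ 0}` gives `‖L‖_{q'} = ‖K‖_{q'}`. On `{J_f = 0}` both
inequalities force `Df = 0`.
-/

section MaximalFunction

open Metric

theorem enorm_sub_le_lintegral_fderiv {E F : Type*} [NormedAddCommGroup E] [NormedSpace ℝ E]
    [NormedAddCommGroup F] [NormedSpace ℝ F] [CompleteSpace F] {v : E → F}
    (hv : ContDiff ℝ 1 v) (x z : E) :
    ‖v z - v x‖ₑ ≤ ∫⁻ t in Ioc (0 : ℝ) 1, ‖fderiv ℝ v (x + t • (z - x))‖ₑ * ‖z - x‖ₑ := by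
  have hline (t : ℝ) : HasDerivAt (fun t : ℝ => x + t • (z - x)) (z - x) t := by
    simpa using ((hasDerivAt_id t).smul_const (z - x)).const_add x
  have hderiv (t : ℝ) : HasDerivAt (fun t : ℝ => v (x + t • (z - x)))
      (fderiv ℝ v (x + t • (z - x)) (z - x)) t :=
    (hv.differentiable one_ne_zero _).hasFDerivAt.comp_hasDerivAt t (hline t)
  have hcont : Continuous fun t : ℝ => fderiv ℝ v (x + t • (z - x)) (z - x) :=
    ((hv.continuous_fderiv one_ne_zero).comp (by fun_prop)).clm_apply continuous_const
  have hftc := intervalIntegral.integral_eq_sub_of_hasDerivAt (fun t _ => hderiv t)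
    (hcont.intervalIntegrable 0 1)
  rw [one_smul, zero_smul, add_zero, add_sub_cancel] at hftc
  rw [← hftc, intervalIntegral.integral_of_le zero_le_one]
  exact (enorm_integral_le_lintegral_enorm _).trans
    (lintegral_mono fun t => ContinuousLinearMap.le_opENorm _ _)

variable {E F : Type*} [NormedAddCommGroup E] [MeasurableSpace E] (μ : Measure E)

/-- The set where the local Hardy–Littlewood maximal function of `g` (averages over closed balls of
radius at most `1`) exceeds `c`. The averages are compared without division, so that no value of
`μ` needs to be excluded. -/
def maximalSuperlevel (g : E → ℝ≥0∞) (c : ℝ≥0∞) : Set E :=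
  {x | ∃ r : ℝ, 0 < r ∧ r ≤ 1 ∧ c * μ (closedBall x r) < ∫⁻ y in closedBall x r, g y ∂μ}

theorem setLIntegral_closedBall_le_of_notMem_maximalSuperlevel {g : E → ℝ≥0∞} {c : ℝ≥0∞} {x : E}
    (hx : x ∉ maximalSuperlevel μ g c) {r : ℝ} (hr : 0 < r) (hr1 : r ≤ 1) :
    ∫⁻ y in closedBall x r, g y ∂μ ≤ c * μ (closedBall x r) :=
  not_lt.1 fun hlt => hx ⟨r, hr, hr1, hlt⟩

variable [NormedSpace ℝ E] [FiniteDimensional ℝ E] [BorelSpace E] [μ.IsAddHaarMeasure]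

theorem mul_measure_maximalSuperlevel_le (g : E → ℝ≥0∞) (c : ℝ≥0∞) :
    c * μ (maximalSuperlevel μ g c) ≤ 5 ^ Module.finrank ℝ E * ∫⁻ y, g y ∂μ := by
  choose! r hr0 hr1 hr using fun x (hx : x ∈ maximalSuperlevel μ g c) => hx
  obtain ⟨u, hut, hdisj, hcov⟩ := Vitali.exists_disjoint_subfamily_covering_enlargement_closedBall
    (maximalSuperlevel μ g c) (fun x => x) r 1 hr1 5 (by norm_num)
  have hcount : u.Countable := hdisj.countable_of_nonempty_interior fun a ha =>
    ⟨a, ball_subset_interior_closedBall (mem_ball_self (hr0 a (hut ha)))⟩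
  have hsub : maximalSuperlevel μ g c ⊆ ⋃ a ∈ u, closedBall a (5 * r a) := by
    intro x hx
    obtain ⟨b, hb, hxb⟩ := hcov x hx
    exact mem_biUnion hb (hxb (mem_closedBall_self (hr0 x hx).le))
  have hball : ∀ a ∈ u, c * μ (closedBall a (5 * r a)) ≤
      5 ^ Module.finrank ℝ E * ∫⁻ y in closedBall a (r a), g y ∂μ := by
    intro a ha
    rw [Measure.addHaar_closedBall_mul μ a (by norm_num) (hr0 a (hut ha)).le,
      ← Measure.addHaar_closedBall_center μ a]
    calc c * (ENNReal.ofReal (5 ^ Module.finrank ℝ E) * μ (closedBall a (r a)))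
        = 5 ^ Module.finrank ℝ E * (c * μ (closedBall a (r a))) := by
          rw [ENNReal.ofReal_pow (by norm_num), ENNReal.ofReal_ofNat]; ring
      _ ≤ _ := by gcongr; exact (hr a (hut ha)).le
  calc c * μ (maximalSuperlevel μ g c) ≤ c * ∑' a : u, μ (closedBall (a : E) (5 * r a)) := by
        gcongr; exact (measure_mono hsub).trans (measure_biUnion_le μ hcount _)
    _ = ∑' a : u, c * μ (closedBall (a : E) (5 * r a)) := ENNReal.tsum_mul_left.symm
    _ ≤ ∑' a : u, 5 ^ Module.finrank ℝ E * ∫⁻ y in closedBall (a : E) (r a), g y ∂μ :=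
        ENNReal.tsum_le_tsum fun a => hball a a.2
    _ = 5 ^ Module.finrank ℝ E * ∑' a : u, ∫⁻ y in closedBall (a : E) (r a), g y ∂μ :=
        ENNReal.tsum_mul_left
    _ = 5 ^ Module.finrank ℝ E * ∫⁻ y in ⋃ a ∈ u, closedBall a (r a), g y ∂μ := by
        rw [lintegral_biUnion hcount (fun a _ => isClosed_closedBall.measurableSet) hdisj]
    _ ≤ _ := by gcongr; exact Measure.restrict_le_self

theorem map_homothety_addHaar (x : E) {t : ℝ} (ht : 0 < t) :
    μ.map (fun z => x + t • (z - x)) = ENNReal.ofReal (t ^ Module.finrank ℝ E)⁻¹ • μ := by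
  have hcomp : (fun z => x + t • (z - x)) = (fun z => x + z) ∘ (fun z => t • z) ∘ (· - x) := rfl
  rw [hcomp, ← Measure.map_map (measurable_const_add x)
      ((measurable_const_smul t).comp (measurable_sub_const x)),
    ← Measure.map_map (measurable_const_smul t) (measurable_sub_const x), map_sub_right_eq_self,
    Measure.map_addHaar_smul μ ht.ne', Measure.map_smul, map_add_left_eq_self,
    abs_of_pos (by positivity)]

theorem setLIntegral_closedBall_comp_homothety_le (g : E → ℝ≥0∞) {m x : E} {r t : ℝ}
    (ht : 0 < t) (hmx : dist m x ≤ r) :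
    ∫⁻ z in closedBall m r, g (x + t • (z - x)) ∂μ ≤
      ENNReal.ofReal (t ^ Module.finrank ℝ E)⁻¹ * ∫⁻ w in closedBall x (t * (2 * r)), g w ∂μ := by
  have hsub : closedBall m r ⊆ (fun z => x + t • (z - x)) ⁻¹' closedBall x (t * (2 * r)) := by
    intro z hz
    rw [mem_preimage, mem_closedBall, dist_self_add_left, norm_smul, Real.norm_of_nonneg ht.le,
      ← dist_eq_norm]
    gcongr
    linarith [dist_triangle z m x, mem_closedBall.1 hz]
  have hme : MeasurableEmbedding fun z : E => x + t • (z - x) :=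
    ((Homeomorph.subRight x).trans
      ((Homeomorph.smulOfNeZero t ht.ne').trans (Homeomorph.addLeft x))).measurableEmbedding
  calc ∫⁻ z in closedBall m r, g (x + t • (z - x)) ∂μ
      ≤ ∫⁻ z in (fun z => x + t • (z - x)) ⁻¹' closedBall x (t * (2 * r)),
          g (x + t • (z - x)) ∂μ := lintegral_mono_set hsub
    _ = ∫⁻ w in closedBall x (t * (2 * r)), g w ∂(μ.map fun z => x + t • (z - x)) := by
        rw [hme.restrict_map, hme.lintegral_map]
    _ = _ := by
        rw [map_homothety_addHaar μ x ht, Measure.restrict_smul, lintegral_smul_measure,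
          smul_eq_mul]

theorem setLIntegral_comp_homothety_le_of_notMem_maximalSuperlevel {g : E → ℝ≥0∞} {c : ℝ≥0∞}
    {m x : E} {r t : ℝ} (hx : x ∉ maximalSuperlevel μ g c) (hr : 0 < r) (hr1 : 2 * r ≤ 1)
    (hmx : dist m x ≤ r) (ht : t ∈ Ioc (0 : ℝ) 1) :
    ∫⁻ z in closedBall m r, g (x + t • (z - x)) ∂μ ≤
      2 ^ Module.finrank ℝ E * c * μ (closedBall m r) := by
  set N := Module.finrank ℝ E
  have htN : 0 < t ^ N := pow_pos ht.1 N
  have hvol : μ (closedBall x (t * (2 * r))) =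
      ENNReal.ofReal (t ^ N) * (2 ^ N * μ (closedBall m r)) := by
    rw [Measure.addHaar_closedBall_mul μ x ht.1.le (by positivity),
      Measure.addHaar_closedBall_mul μ 0 zero_le_two hr.le, Measure.addHaar_closedBall_center μ m,
      ENNReal.ofReal_pow zero_le_two, ENNReal.ofReal_ofNat]
  calc ∫⁻ z in closedBall m r, g (x + t • (z - x)) ∂μ
      ≤ ENNReal.ofReal (t ^ N)⁻¹ * ∫⁻ w in closedBall x (t * (2 * r)), g w ∂μ :=
        setLIntegral_closedBall_comp_homothety_le μ g ht.1 hmx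
    _ ≤ ENNReal.ofReal (t ^ N)⁻¹ * (c * μ (closedBall x (t * (2 * r)))) := by
        gcongr
        exact setLIntegral_closedBall_le_of_notMem_maximalSuperlevel μ hx
          (mul_pos ht.1 (by positivity)) (mul_le_one₀ ht.2 (by positivity) hr1)
    _ = (ENNReal.ofReal (t ^ N)⁻¹ * ENNReal.ofReal (t ^ N)) *
          (2 ^ N * c * μ (closedBall m r)) := by rw [hvol]; ring
    _ = _ := by
        rw [← ENNReal.ofReal_mul (by positivity), inv_mul_cancel₀ htN.ne', ENNReal.ofReal_one,
          one_mul]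

variable [NormedAddCommGroup F] [NormedSpace ℝ F] [CompleteSpace F]

theorem setLIntegral_enorm_sub_le_of_notMem_maximalSuperlevel {v : E → F} (hv : ContDiff ℝ 1 v)
    {c : ℝ≥0∞} {m x : E} {r : ℝ} (hx : x ∉ maximalSuperlevel μ (fun y => ‖fderiv ℝ v y‖ₑ) c)
    (hr : 0 < r) (hr1 : 2 * r ≤ 1) (hmx : dist m x ≤ r) :
    ∫⁻ z in closedBall m r, ‖v z - v x‖ₑ ∂μ ≤
      ENNReal.ofReal (2 * r) * (2 ^ Module.finrank ℝ E * c) * μ (closedBall m r) := by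
  have hcont : Continuous fun q : E × ℝ => ‖fderiv ℝ v (x + q.2 • (q.1 - x))‖ₑ :=
    ((hv.continuous_fderiv one_ne_zero).comp (by fun_prop)).enorm
  calc ∫⁻ z in closedBall m r, ‖v z - v x‖ₑ ∂μ
      ≤ ∫⁻ z in closedBall m r, (∫⁻ t in Ioc (0 : ℝ) 1,
          ‖fderiv ℝ v (x + t • (z - x))‖ₑ * ENNReal.ofReal (2 * r)) ∂μ := by
        refine setLIntegral_mono' isClosed_closedBall.measurableSet fun z hz => ?_
        refine (enorm_sub_le_lintegral_fderiv hv x z).trans (lintegral_mono fun t => ?_)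
        rw [← ofReal_norm (z - x), ← dist_eq_norm]
        gcongr
        linarith [dist_triangle z m x, mem_closedBall.1 hz]
    _ = ∫⁻ t in Ioc (0 : ℝ) 1, ∫⁻ z in closedBall m r,
          ‖fderiv ℝ v (x + t • (z - x))‖ₑ * ENNReal.ofReal (2 * r) ∂μ :=
        lintegral_lintegral_swap (hcont.measurable.mul_const _).aemeasurable
    _ ≤ ∫⁻ _ in Ioc (0 : ℝ) 1,
          2 ^ Module.finrank ℝ E * c * μ (closedBall m r) * ENNReal.ofReal (2 * r) := by
        refine setLIntegral_mono' measurableSet_Ioc fun t ht => ?_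
        rw [lintegral_mul_const' _ _ ENNReal.ofReal_ne_top]
        gcongr
        exact setLIntegral_comp_homothety_le_of_notMem_maximalSuperlevel μ hx hr hr1 hmx ht
    _ = _ := by
        rw [setLIntegral_const, Real.volume_Ioc, sub_zero, ENNReal.ofReal_one, mul_one]; ring

theorem enorm_sub_le_of_notMem_maximalSuperlevel {v : E → F} (hv : ContDiff ℝ 1 v) {x y : E}
    {c : ℝ≥0∞} (hx : x ∉ maximalSuperlevel μ (fun z => ‖fderiv ℝ v z‖ₑ) c)
    (hy : y ∉ maximalSuperlevel μ (fun z => ‖fderiv ℝ v z‖ₑ) c) (hxy : dist y x ≤ 1) :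
    ‖v y - v x‖ₑ ≤ 2 ^ (Module.finrank ℝ E + 1) * c * ‖y - x‖ₑ := by
  rcases eq_or_ne y x with rfl | hne
  · simp
  set m := midpoint ℝ y x
  set r := dist y x / 2 with hr
  have hr0 : 0 < r := half_pos (dist_pos.2 hne)
  have hr2 : 2 * r = dist y x := by rw [hr]; ring
  have hmy : dist m y ≤ r := by
    rw [dist_midpoint_left, Real.norm_ofNat, inv_mul_eq_div]
  have hmx : dist m x ≤ r := by
    rw [dist_midpoint_right, Real.norm_ofNat, inv_mul_eq_div]
  have hball : ‖v y - v x‖ₑ * μ (closedBall m r) ≤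
      2 ^ (Module.finrank ℝ E + 1) * c * ‖y - x‖ₑ * μ (closedBall m r) := by
    calc ‖v y - v x‖ₑ * μ (closedBall m r)
        = ∫⁻ _ in closedBall m r, ‖v y - v x‖ₑ ∂μ := (setLIntegral_const _ _).symm
      _ ≤ ∫⁻ z in closedBall m r, (‖v z - v x‖ₑ + ‖v z - v y‖ₑ) ∂μ :=
          lintegral_mono fun z => by
            simpa only [sub_sub_sub_cancel_left] using
              enorm_sub_le (a := v z - v x) (b := v z - v y)
      _ = ∫⁻ z in closedBall m r, ‖v z - v x‖ₑ ∂μ + ∫⁻ z in closedBall m r, ‖v z - v y‖ₑ ∂μ :=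
          lintegral_add_left (hv.continuous.sub continuous_const).enorm.measurable _
      _ ≤ _ := add_le_add
          (setLIntegral_enorm_sub_le_of_notMem_maximalSuperlevel μ hv hx hr0 (hr2 ▸ hxy) hmx)
          (setLIntegral_enorm_sub_le_of_notMem_maximalSuperlevel μ hv hy hr0 (hr2 ▸ hxy) hmy)
      _ = _ := by rw [← ofReal_norm (y - x), ← dist_eq_norm, ← hr2]; ring
  exact (ENNReal.mul_le_mul_iff_left (measure_closedBall_pos μ m hr0).ne'
    measure_closedBall_lt_top.ne).1 hball

end MaximalFunction

section BilinearIntegrals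

theorem integrable_of_norm_le_of_isCompact {X V : Type*} [TopologicalSpace X] [MeasurableSpace X]
    [NormedAddCommGroup V] {μ : Measure X} [IsFiniteMeasureOnCompacts μ] {K : Set X} {ψ : X → V}
    {C : ℝ} (hψ : AEStronglyMeasurable ψ μ) (hC : ∀ x, ‖ψ x‖ ≤ C) (hK : IsCompact K)
    (hψK : ∀ x ∉ K, ψ x = 0) : Integrable ψ μ :=
  IntegrableOn.integrable_of_forall_notMem_eq_zero (s := K)
    (Measure.integrableOn_of_bounded hK.measure_lt_top.ne hψ (.of_forall hC)) hψK

variable {X V W H : Type*} [TopologicalSpace X] [T2Space X] [MeasurableSpace X]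
  [OpensMeasurableSpace X] {μ : Measure X} [NormedAddCommGroup V] [NormedSpace ℝ V]
  [NormedAddCommGroup W] [NormedSpace ℝ W] [NormedAddCommGroup H] [NormedSpace ℝ H]

theorem integrable_bilin_of_tsupport_subset (B : V →L[ℝ] W →L[ℝ] H) {Ω : Set X} {ψ : X → V}
    (hψ : Continuous ψ) (hψs : HasCompactSupport ψ) (hψΩ : tsupport ψ ⊆ Ω) {D : X → W}
    (hD : LocallyIntegrableOn D Ω μ) : Integrable (fun x => B (ψ x) (D x)) μ := by
  have hDK : IntegrableOn D (tsupport ψ) μ := hD.integrableOn_compact_subset hψΩ hψs.isCompact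
  have hψK : AEStronglyMeasurable ψ (μ.restrict (tsupport ψ)) :=
    hψ.continuousOn.aestronglyMeasurable_of_isCompact hψs.isCompact hψs.isCompact.measurableSet
  obtain ⟨C, hC⟩ := hψ.bounded_above_of_compact_support hψs
  have hint : IntegrableOn (fun x => B (ψ x) (D x)) (tsupport ψ) μ :=
    B.integrable_of_bilin_of_bdd_left C hψK (.of_forall hC) hDK
  exact hint.integrable_of_forall_notMem_eq_zero fun x hx => by
    rw [image_eq_zero_of_notMem_tsupport hx, map_zero, zero_apply]

end BilinearIntegrals

section Mollification

open Metric Filter Topology ContinuousLinearMap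
open scoped Convolution

variable {E F : Type*} [NormedAddCommGroup E]

/-- The bump function at the origin with outer radius `1 / (k + 1)` and half that inner radius;
normalized, these are the mollifiers. -/
noncomputable def shrinkingBump (E : Type*) [NormedAddCommGroup E] (k : ℕ) :
    ContDiffBump (0 : E) where
  rIn := 1 / (k + 1) / 2
  rOut := 1 / (k + 1)
  rIn_pos := by positivity
  rIn_lt_rOut := half_lt_self (by positivity)

theorem tendsto_rOut_shrinkingBump :
    Tendsto (fun k => (shrinkingBump E k).rOut) atTop (𝓝 0) :=
  tendsto_one_div_add_atTop_nhds_zero_nat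

theorem rOut_shrinkingBump_le_one (k : ℕ) : (shrinkingBump E k).rOut ≤ 1 := by
  change (1 : ℝ) / (k + 1) ≤ 1
  rw [div_le_one (by positivity)]
  linarith [(Nat.cast_nonneg k : (0 : ℝ) ≤ k)]

theorem eventually_cthickening_rOut_subset {K Ω : Set E} (hK : IsCompact K) (hΩ : IsOpen Ω)
    (hKΩ : K ⊆ Ω) : ∀ᶠ k in atTop, cthickening (shrinkingBump E k).rOut K ⊆ Ω := by
  obtain ⟨δ, hδ, hδΩ⟩ := hK.exists_cthickening_subset_open hΩ hKΩ
  filter_upwards [(tendsto_rOut_shrinkingBump (E := E)).eventually (gt_mem_nhds hδ)] with k hk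
  exact (cthickening_mono hk.le K).trans hδΩ

variable [NormedSpace ℝ E] [FiniteDimensional ℝ E] [MeasurableSpace E] [BorelSpace E]
  {μ : Measure E} [μ.IsAddHaarMeasure] [NormedAddCommGroup F] [NormedSpace ℝ F]

theorem lintegral_enorm_shrinkingBump (k : ℕ) :
    ∫⁻ t, ‖(shrinkingBump E k).normed μ t‖ₑ ∂μ = 1 := by
  rw [← ofReal_integral_norm_eq_lintegral_enorm (shrinkingBump E k).integrable_normed]
  simp_rw [Real.norm_of_nonneg ((shrinkingBump E k).nonneg_normed _)]
  rw [(shrinkingBump E k).integral_normed, ENNReal.ofReal_one]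

variable (μ) in
/-- The mollification of `g` at scale `1 / (k + 1)`. -/
noncomputable def mollify (g : E → F) (k : ℕ) : E → F :=
  (shrinkingBump E k).normed μ ⋆[lsmul ℝ ℝ, μ] g

theorem contDiff_mollify {g : E → F} (hg : LocallyIntegrable g μ) (n : ℕ∞) (k : ℕ) :
    ContDiff ℝ n (mollify μ g k) :=
  (shrinkingBump E k).hasCompactSupport_normed.contDiff_convolution_left _
    (shrinkingBump E k).contDiff_normed hg

theorem hasFDerivAt_mollify_of_contDiff {φ : E → F} (hφ : ContDiff ℝ 1 φ)
    (hφs : HasCompactSupport φ) (k : ℕ) (x : E) :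
    HasFDerivAt (mollify μ φ k) (mollify μ (fderiv ℝ φ) k x) x :=
  hφs.hasFDerivAt_convolution_right (lsmul ℝ ℝ)
    (shrinkingBump E k).integrable_normed.locallyIntegrable hφ x

theorem mollify_sub {g h : E → F} (hg : LocallyIntegrable g μ) (hh : LocallyIntegrable h μ)
    (k : ℕ) (x : E) : mollify μ (fun y => g y - h y) k x = mollify μ g k x - mollify μ h k x := by
  have key : ∀ f : E → F, LocallyIntegrable f μ →
      Integrable (fun t => (shrinkingBump E k).normed μ t • f (x - t)) μ := fun f hf =>
    (shrinkingBump E k).hasCompactSupport_normed.convolutionExists_left (lsmul ℝ ℝ)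
      (shrinkingBump E k).continuous_normed hf x
  simp only [mollify, convolution_lsmul, smul_sub]
  exact integral_sub (key g hg) (key h hh)

theorem norm_mollify_le {g : E → F} {C : ℝ} (hC : ∀ x, ‖g x‖ ≤ C) (k : ℕ) (x : E) :
    ‖mollify μ g k x‖ ≤ C := by
  have hi := (shrinkingBump E k).integrable_normed (μ := μ)
  calc ‖mollify μ g k x‖ ≤ ∫ t, (shrinkingBump E k).normed μ t * C ∂μ := by
        refine norm_integral_le_of_norm_le (hi.mul_const C) (Eventually.of_forall fun t => ?_)
        rw [lsmul_apply, norm_smul, Real.norm_of_nonneg ((shrinkingBump E k).nonneg_normed _)]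
        exact mul_le_mul_of_nonneg_left (hC _) ((shrinkingBump E k).nonneg_normed _)
    _ = C := by rw [integral_mul_const, (shrinkingBump E k).integral_normed, one_mul]

theorem lintegral_enorm_mollify_le {g : E → F} (hg : AEStronglyMeasurable g μ) (k : ℕ) :
    ∫⁻ x, ‖mollify μ g k x‖ₑ ∂μ ≤ ∫⁻ x, ‖g x‖ₑ ∂μ := by
  set φ := (shrinkingBump E k).normed μ
  have hφ : AEStronglyMeasurable φ μ := (shrinkingBump E k).continuous_normed.aestronglyMeasurable
  calc ∫⁻ x, ‖mollify μ g k x‖ₑ ∂μ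
      ≤ ∫⁻ x, ∫⁻ t, ‖lsmul ℝ ℝ (φ t) (g (x - t))‖ₑ ∂μ ∂μ :=
        lintegral_mono fun x => enorm_integral_le_lintegral_enorm _
    _ = ∫⁻ t, ∫⁻ x, ‖lsmul ℝ ℝ (φ t) (g (x - t))‖ₑ ∂μ ∂μ :=
        lintegral_lintegral_swap (hφ.convolution_integrand (lsmul ℝ ℝ) hg).enorm
    _ = ∫⁻ t, ‖φ t‖ₑ * ∫⁻ x, ‖g x‖ₑ ∂μ ∂μ := by
        refine lintegral_congr fun t => ?_
        simp_rw [lsmul_apply, enorm_smul]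
        rw [lintegral_const_mul' _ _ enorm_ne_top, lintegral_sub_right_eq_self (fun x => ‖g x‖ₑ)]
    _ = ∫⁻ x, ‖g x‖ₑ ∂μ := by
        rw [lintegral_mul_const'' _ hφ.enorm, lintegral_enorm_shrinkingBump, one_mul]

variable [CompleteSpace F]

theorem mollify_eq_zero_of_notMem_cthickening {g : E → F} {K : Set E}
    (hK : ∀ x ∉ K, g x = 0) {k : ℕ} {x : E}
    (hx : x ∉ cthickening (shrinkingBump E k).rOut K) : mollify μ g k x = 0 := by
  have hzero : ∀ y ∈ ball x (shrinkingBump E k).rOut, g y = 0 := by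
    intro y hy
    by_contra hne
    have hyK : y ∈ K := by_contra fun h => hne (hK y h)
    exact hx (mem_cthickening_of_dist_le x y _ _ hyK (by rw [dist_comm]; exact (mem_ball.1 hy).le))
  have hgx := hzero x (mem_ball_self (shrinkingBump E k).rOut_pos)
  rw [← hgx]
  exact ContDiffBump.normed_convolution_eq_right fun y hy => by rw [hzero y hy, hgx]

theorem tsupport_mollify_subset {g : E → F} {K : Set E} (hK : ∀ x ∉ K, g x = 0) (k : ℕ) :
    tsupport (mollify μ g k) ⊆ cthickening (shrinkingBump E k).rOut K :=
  closure_minimal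
    (fun _ hx => by_contra fun hnot => hx (mollify_eq_zero_of_notMem_cthickening hK hnot))
    isClosed_cthickening

theorem tendsto_mollify_of_continuous {g : E → F} (hg : Continuous g) (x : E) :
    Tendsto (fun k => mollify μ g k x) atTop (𝓝 (g x)) :=
  ContDiffBump.convolution_tendsto_right_of_continuous tendsto_rOut_shrinkingBump hg x

theorem ae_tendsto_mollify {g : E → F} (hg : LocallyIntegrable g μ) :
    ∀ᵐ x ∂μ, Tendsto (fun k => mollify μ g k x) atTop (𝓝 (g x)) := by
  refine ContDiffBump.ae_convolution_tendsto_right_of_locallyIntegrable (K := 2)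
    tendsto_rOut_shrinkingBump (Eventually.of_forall fun k => ?_) hg
  change (1 : ℝ) / (k + 1) ≤ 2 * (1 / (k + 1) / 2)
  linarith

theorem tendsto_lintegral_enorm_mollify_sub_of_continuous {h : E → F} (hh : Continuous h)
    (hs : HasCompactSupport h) :
    Tendsto (fun k => ∫⁻ x, ‖mollify μ h k x - h x‖ₑ ∂μ) atTop (𝓝 0) := by
  obtain ⟨M, hM⟩ := hh.bounded_above_of_compact_support hs
  have hK : IsCompact (cthickening 1 (tsupport h)) := hs.isCompact.cthickening
  have hz : ∀ x ∉ tsupport h, h x = 0 := fun x hx => image_eq_zero_of_notMem_tsupport hx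
  have hlim : Tendsto (fun k => ∫⁻ x, ‖mollify μ h k x - h x‖ₑ ∂μ) atTop
      (𝓝 (∫⁻ _, 0 ∂μ)) := by
    refine tendsto_lintegral_of_dominated_convergence
      ((cthickening 1 (tsupport h)).indicator fun _ => ENNReal.ofReal (M + M))
      (fun k => ?_) (fun k => Eventually.of_forall fun x => ?_) ?_
      (Eventually.of_forall fun x => ?_)
    · exact (((contDiff_mollify hh.locallyIntegrable 0 k).continuous).sub hh).enorm.measurable
    · beta_reduce
      by_cases hx : x ∈ cthickening 1 (tsupport h)
      · rw [indicator_of_mem hx, ← ofReal_norm]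
        exact ENNReal.ofReal_le_ofReal
          ((norm_sub_le _ _).trans (add_le_add (norm_mollify_le hM k x) (hM x)))
      · rw [indicator_of_notMem hx, mollify_eq_zero_of_notMem_cthickening hz
          (fun hc => hx (cthickening_mono (rOut_shrinkingBump_le_one k) _ hc)),
          hz x (fun hc => hx (self_subset_cthickening _ hc))]
        simp
    · rw [lintegral_indicator hK.measurableSet, setLIntegral_const]
      exact ENNReal.mul_ne_top ENNReal.ofReal_ne_top hK.measure_lt_top.ne
    · have := ((tendsto_mollify_of_continuous (μ := μ) hh x).sub_const (h x)).enorm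
      simpa using this
  simpa using hlim

theorem tendsto_lintegral_enorm_mollify_sub {g : E → F} (hg : Integrable g μ) :
    Tendsto (fun k => ∫⁻ x, ‖mollify μ g k x - g x‖ₑ ∂μ) atTop (𝓝 0) := by
  rw [ENNReal.tendsto_atTop_zero]
  intro ε hε
  have hε3 : ε / 3 ≠ 0 := (ENNReal.div_pos hε.ne' (by simp)).ne'
  obtain ⟨h, hs, hle, hh, hhi⟩ := hg.exists_hasCompactSupport_lintegral_sub_le hε3
  obtain ⟨N, hN⟩ := ENNReal.tendsto_atTop_zero.1
    (tendsto_lintegral_enorm_mollify_sub_of_continuous (μ := μ) hh hs) (ε / 3)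
    (pos_iff_ne_zero.2 hε3)
  refine ⟨N, fun k hk => ?_⟩
  have hmeas : ∀ {f : E → F}, LocallyIntegrable f μ → AEStronglyMeasurable (mollify μ f k) μ :=
    fun hf => (contDiff_mollify hf 0 k).continuous.aestronglyMeasurable
  have hgh : Integrable (fun y => g y - h y) μ := hg.sub hhi
  calc ∫⁻ x, ‖mollify μ g k x - g x‖ₑ ∂μ
      ≤ ∫⁻ x, (‖mollify μ (fun y => g y - h y) k x‖ₑ + ‖mollify μ h k x - h x‖ₑ
          + ‖g x - h x‖ₑ) ∂μ := by
        refine lintegral_mono fun x => ?_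
        rw [mollify_sub hg.locallyIntegrable hhi.locallyIntegrable]
        calc ‖mollify μ g k x - g x‖ₑ
            = ‖((mollify μ g k x - mollify μ h k x) + (mollify μ h k x - h x))
                - (g x - h x)‖ₑ := by congr 1; abel
          _ ≤ _ := enorm_sub_le.trans (add_le_add_left (enorm_add_le _ _) _)
    _ = ∫⁻ x, ‖mollify μ (fun y => g y - h y) k x‖ₑ ∂μ + ∫⁻ x, ‖mollify μ h k x - h x‖ₑ ∂μ
          + ∫⁻ x, ‖g x - h x‖ₑ ∂μ := by
        rw [lintegral_add_right' _ hgh.aestronglyMeasurable.enorm,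
          lintegral_add_left' (hmeas hgh.locallyIntegrable).enorm]
    _ ≤ ε / 3 + ε / 3 + ε / 3 := by
        gcongr
        · exact (lintegral_enorm_mollify_le hgh.aestronglyMeasurable k).trans hle
        · exact hN k hk
    _ = ε := ENNReal.add_thirds ε

theorem tendsto_integral_bilin_mollify {W H : Type*} [NormedAddCommGroup W] [NormedSpace ℝ W]
    [NormedAddCommGroup H] [NormedSpace ℝ H] (B : F →L[ℝ] W →L[ℝ] H) {K Ω : Set E}
    (hK : IsCompact K) (hΩ : IsOpen Ω) (hKΩ : K ⊆ Ω) {ψ : E → F}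
    (hψ : AEStronglyMeasurable ψ μ) {C : ℝ} (hC : ∀ x, ‖ψ x‖ ≤ C) (hψK : ∀ x ∉ K, ψ x = 0)
    {D : E → W} (hD : LocallyIntegrableOn D Ω μ) :
    Tendsto (fun k => ∫ x, B (mollify μ ψ k x) (D x) ∂μ) atTop (𝓝 (∫ x, B (ψ x) (D x) ∂μ)) := by
  obtain ⟨δ, hδ, hδΩ⟩ := hK.exists_cthickening_subset_open hΩ hKΩ
  set K' := cthickening δ K
  have hDK : IntegrableOn D K' μ := hD.integrableOn_compact_subset hδΩ hK.cthickening
  have hψi : Integrable ψ μ := integrable_of_norm_le_of_isCompact hψ hC hK hψK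
  have hsupp (φ : E → F) (hφ : ∀ x ∉ K', φ x = 0) :
      ∫ x in K', B (φ x) (D x) ∂μ = ∫ x, B (φ x) (D x) ∂μ :=
    setIntegral_eq_integral_of_forall_compl_eq_zero fun x hx => by
      rw [hφ x hx, map_zero, zero_apply]
  have hlim : Tendsto (fun k => ∫ x in K', B (mollify μ ψ k x) (D x) ∂μ) atTop
      (𝓝 (∫ x in K', B (ψ x) (D x) ∂μ)) := by
    refine tendsto_integral_of_dominated_convergence (fun x => ‖B‖ * C * ‖D x‖) (fun k => ?_)
      (hDK.norm.const_mul _) (fun k => .of_forall fun x => ?_)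
      (ae_restrict_of_ae ((ae_tendsto_mollify hψi.locallyIntegrable).mono fun x hx => ?_))
    · exact B.aestronglyMeasurable_comp₂ (contDiff_mollify hψi.locallyIntegrable 0
        k).continuous.aestronglyMeasurable hDK.aestronglyMeasurable
    · exact (B.le_opNorm₂ _ _).trans (by gcongr; exact norm_mollify_le hC k x)
    · exact ((B.flip (D x)).continuous.tendsto _).comp hx
  rw [hsupp ψ fun x hx => hψK x fun hxK => hx (self_subset_cthickening K hxK)] at hlim
  refine hlim.congr' ?_
  filter_upwards [(tendsto_rOut_shrinkingBump (E := E)).eventually (gt_mem_nhds hδ)] with k hk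
  exact hsupp _ fun x hx => mollify_eq_zero_of_notMem_cthickening hψK
    fun hxk => hx (cthickening_mono hk.le K hxk)

end Mollification

section WeakDerivative

open Metric Filter Topology ContinuousLinearMap
open scoped Convolution

variable {E F : Type*} [NormedAddCommGroup E] [NormedSpace ℝ E] [MeasurableSpace E]
  [NormedAddCommGroup F] [NormedSpace ℝ F]

/-- `u` is a function of class `W^{1,1}_loc` on `Ω` with weak derivative `g`: the coordinate-free
counterpart of `HasLocSobolevDeriv`, tested against scalar functions in `C_c^∞(Ω)` and all
directions. The integrals run over the whole space since the test functions vanish off `Ω`. -/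
structure HasWeakFDerivOn (μ : Measure E) (Ω : Set E) (u : E → F) (g : E → E →L[ℝ] F) :
    Prop where
  locallyIntegrableOn : LocallyIntegrableOn u Ω μ
  locallyIntegrableOn_deriv : LocallyIntegrableOn g Ω μ
  integral_fderiv_smul : ∀ φ : E → ℝ, ContDiff ℝ ∞ φ → HasCompactSupport φ → tsupport φ ⊆ Ω →
    ∀ w : E, ∫ x, fderiv ℝ φ x w • u x ∂μ = - ∫ x, φ x • g x w ∂μ

namespace HasWeakFDerivOn

variable {μ : Measure E} {Ω : Set E} {u : E → F} {g : E → E →L[ℝ] F}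

variable [BorelSpace E]

theorem integral_fderiv_smul_cutoff_smul (h : HasWeakFDerivOn μ Ω u g) {η φ : E → ℝ}
    (hη : ContDiff ℝ ∞ η) (hηs : HasCompactSupport η) (hηΩ : tsupport η ⊆ Ω)
    (hφ : ContDiff ℝ ∞ φ) (w : E) :
    ∫ x, fderiv ℝ φ x w • η x • u x ∂μ =
      - ∫ x, φ x • (η x • g x w + fderiv ℝ η x w • u x) ∂μ := by
  have hφη : ContDiff ℝ ∞ fun x => φ x * η x := hφ.mul hη
  have hφηs : HasCompactSupport fun x => φ x * η x := hηs.mul_left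
  have hφηΩ : tsupport (fun x => φ x * η x) ⊆ Ω := tsupport_mul_subset_right.trans hηΩ
  have hη' : Continuous fun x => fderiv ℝ η x w :=
    (hη.continuous_fderiv (by simp)).clm_apply continuous_const
  have hφη' : Continuous fun x => fderiv ℝ (fun y => φ y * η y) x w :=
    (hφη.continuous_fderiv (by simp)).clm_apply continuous_const
  have hint_u : Integrable (fun x => fderiv ℝ (fun y => φ y * η y) x w • u x) μ :=
    integrable_bilin_of_tsupport_subset (lsmul ℝ ℝ) hφη' (hφηs.fderiv_apply ℝ w)
      ((tsupport_fderiv_apply_subset ℝ w).trans hφηΩ) h.locallyIntegrableOn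
  have hint_η : Integrable (fun x => (φ x * fderiv ℝ η x w) • u x) μ :=
    integrable_bilin_of_tsupport_subset (lsmul ℝ ℝ) (hφ.continuous.mul hη')
      (hηs.fderiv_apply ℝ w).mul_left
      ((tsupport_mul_subset_right.trans (tsupport_fderiv_apply_subset ℝ w)).trans hηΩ)
      h.locallyIntegrableOn
  have hint_g : Integrable (fun x => (φ x * η x) • g x w) μ :=
    integrable_bilin_of_tsupport_subset (lsmul ℝ ℝ) hφη.continuous hφηs hφηΩ
      ((apply ℝ F w).locallyIntegrableOn_comp h.locallyIntegrableOn_deriv)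
  have hprod (x : E) : fderiv ℝ φ x w • η x • u x =
      fderiv ℝ (fun y => φ y * η y) x w • u x - (φ x * fderiv ℝ η x w) • u x := by
    rw [fderiv_fun_mul (hφ.differentiable (by simp) x) (hη.differentiable (by simp) x), add_apply,
      smul_apply, smul_apply, smul_eq_mul, smul_eq_mul, add_smul, add_sub_cancel_left,
      smul_smul, mul_comm]
  simp_rw [hprod]
  rw [integral_sub hint_u hint_η, h.integral_fderiv_smul _ hφη hφηs hφηΩ, ← neg_add',
    ← integral_add hint_g hint_η]
  simp only [smul_add, smul_smul]

theorem integrable_deriv_smul (h : HasWeakFDerivOn μ Ω u g) {η : E → ℝ} (hη : ContDiff ℝ 1 η)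
    (hηs : HasCompactSupport η) (hηΩ : tsupport η ⊆ Ω) :
    Integrable (fun x => η x • g x + (fderiv ℝ η x).smulRight (u x)) μ :=
  (integrable_bilin_of_tsupport_subset (lsmul ℝ ℝ) hη.continuous hηs hηΩ
    h.locallyIntegrableOn_deriv).add
    (integrable_bilin_of_tsupport_subset (smulRightL ℝ E F) (hη.continuous_fderiv one_ne_zero)
      (hηs.fderiv ℝ) ((tsupport_fderiv_subset ℝ).trans hηΩ) h.locallyIntegrableOn)

theorem smul_of_tsupport_subset (h : HasWeakFDerivOn μ Ω u g) {η : E → ℝ}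
    (hη : ContDiff ℝ ∞ η) (hηs : HasCompactSupport η) (hηΩ : tsupport η ⊆ Ω) :
    HasWeakFDerivOn μ univ (fun x => η x • u x)
      (fun x => η x • g x + (fderiv ℝ η x).smulRight (u x)) where
  locallyIntegrableOn := (integrable_bilin_of_tsupport_subset (lsmul ℝ ℝ) hη.continuous hηs hηΩ
    h.locallyIntegrableOn).locallyIntegrable.locallyIntegrableOn univ
  locallyIntegrableOn_deriv := (h.integrable_deriv_smul (hη.of_le (by simp)) hηs
    hηΩ).locallyIntegrable.locallyIntegrableOn univ
  integral_fderiv_smul _ hφ _ _ w := h.integral_fderiv_smul_cutoff_smul hη hηs hηΩ hφ w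

variable [FiniteDimensional ℝ E] [μ.IsAddHaarMeasure]

theorem integral_fderiv_smul_of_contDiff_one (h : HasWeakFDerivOn μ Ω u g) (hΩ : IsOpen Ω)
    {φ : E → ℝ} (hφ : ContDiff ℝ 1 φ) (hφs : HasCompactSupport φ) (hφΩ : tsupport φ ⊆ Ω) (w : E) :
    ∫ x, fderiv ℝ φ x w • u x ∂μ = - ∫ x, φ x • g x w ∂μ := by
  have hφ' : Continuous (fderiv ℝ φ) := hφ.continuous_fderiv one_ne_zero
  obtain ⟨C, hC⟩ := hφ.continuous.bounded_above_of_compact_support hφs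
  obtain ⟨C', hC'⟩ := hφ'.bounded_above_of_compact_support (hφs.fderiv ℝ)
  have hzero (x : E) (hx : x ∉ tsupport φ) : φ x = 0 := image_eq_zero_of_notMem_tsupport hx
  have hzero' (x : E) (hx : x ∉ tsupport φ) : fderiv ℝ φ x = 0 :=
    image_eq_zero_of_notMem_tsupport fun hx' => hx (tsupport_fderiv_subset ℝ hx')
  have hlim_u : Tendsto (fun k => ∫ x, fderiv ℝ (mollify μ φ k) x w • u x ∂μ) atTop
      (𝓝 (∫ x, fderiv ℝ φ x w • u x ∂μ)) := by
    simp_rw [fun k x => (hasFDerivAt_mollify_of_contDiff (μ := μ) hφ hφs k x).fderiv]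
    exact tendsto_integral_bilin_mollify ((lsmul ℝ ℝ).comp (apply ℝ ℝ w)) hφs.isCompact hΩ
      hφΩ hφ'.aestronglyMeasurable hC' hzero' h.locallyIntegrableOn
  have hlim_g : Tendsto (fun k => ∫ x, mollify μ φ k x • g x w ∂μ) atTop
      (𝓝 (∫ x, φ x • g x w ∂μ)) :=
    tendsto_integral_bilin_mollify (lsmul ℝ ℝ) hφs.isCompact hΩ hφΩ
      hφ.continuous.aestronglyMeasurable hC hzero
      ((apply ℝ F w).locallyIntegrableOn_comp h.locallyIntegrableOn_deriv)
  refine tendsto_nhds_unique hlim_u (hlim_g.neg.congr' ?_)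
  filter_upwards [eventually_cthickening_rOut_subset hφs.isCompact hΩ hφΩ] with k hk
  have hsupp := tsupport_mollify_subset (μ := μ) hzero k
  exact (h.integral_fderiv_smul _ (contDiff_mollify hφ.continuous.locallyIntegrable ⊤ k)
    (hφs.isCompact.cthickening.of_isClosed_subset (isClosed_tsupport _) hsupp)
    (hsupp.trans hk) w).symm

theorem hasFDerivAt_mollify (h : HasWeakFDerivOn μ univ u g) (k : ℕ) (x : E) :
    HasFDerivAt (mollify μ u k) (mollify μ g k x) x := by
  have hu : LocallyIntegrable u μ := locallyIntegrableOn_univ.1 h.locallyIntegrableOn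
  have hg : LocallyIntegrable g μ := locallyIntegrableOn_univ.1 h.locallyIntegrableOn_deriv
  set φ := (shrinkingBump E k).normed μ
  have hφs : HasCompactSupport φ := (shrinkingBump E k).hasCompactSupport_normed
  have hφ : ContDiff ℝ ∞ φ := (shrinkingBump E k).contDiff_normed
  have hφ1 : ContDiff ℝ 1 φ := (shrinkingBump E k).contDiff_normed
  suffices hconv : mollify μ g k x = (fderiv ℝ φ ⋆[(lsmul ℝ ℝ).precompL E, μ] u) x by
    rw [hconv]
    exact hφs.hasFDerivAt_convolution_left (lsmul ℝ ℝ) hφ1 hu x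
  ext w
  have hmollify : mollify μ g k x w = ∫ t, φ (x - t) • g t w ∂μ := by
    rw [mollify, convolution_eq_swap, ContinuousLinearMap.integral_apply
      (convolutionExistsAt_iff_integrable_swap.1
        (hφs.convolutionExists_left (lsmul ℝ ℝ) hφ.continuous hg x))]
    rfl
  have hderiv : (fderiv ℝ φ ⋆[(lsmul ℝ ℝ).precompL E, μ] u) x w =
      ∫ t, fderiv ℝ φ (x - t) w • u t ∂μ := by
    rw [convolution_eq_swap, ContinuousLinearMap.integral_apply
      (convolutionExistsAt_iff_integrable_swap.1 ((hφs.fderiv ℝ).convolutionExists_left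
        ((lsmul ℝ ℝ).precompL E) (hφ1.continuous_fderiv one_ne_zero) hu x))]
    rfl
  have hweak := h.integral_fderiv_smul (fun t => φ (x - t))
    (hφ.comp (contDiff_const.sub contDiff_id)) (hφs.comp_homeomorph (Homeomorph.subLeft x))
    (subset_univ _) w
  have hreflect (t : E) : fderiv ℝ (fun t => φ (x - t)) t w = - fderiv ℝ φ (x - t) w := by
    have hcomp : HasFDerivAt (fun t => φ (x - t)) _ t :=
      (hφ1.differentiable one_ne_zero (x - t)).hasFDerivAt.comp t ((hasFDerivAt_id t).const_sub x)
    rw [hcomp.fderiv, comp_apply, neg_apply, coe_id', id, map_neg]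
  simp_rw [hreflect, neg_smul, integral_neg, neg_inj] at hweak
  rw [hmollify, hderiv, hweak]

end HasWeakFDerivOn

end WeakDerivative

section ApproximateDifferentiability

open Metric Filter Topology ContinuousLinearMap

theorem exists_measurableSet_cover_of_tsum_ne_top {α : Type*} [MeasurableSpace α] {μ : Measure α}
    {bad : ℕ → Set α} (hbad : ∑' k, μ (bad k) ≠ ⊤) {p : α → Prop} (hp : ∀ᵐ x ∂μ, p x) :
    ∃ A : ℕ → Set α, (∀ m, MeasurableSet (A m)) ∧ (∀ᵐ x ∂μ, x ∈ ⋃ m, A m) ∧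
      ∀ m, ∀ x ∈ A m, p x ∧ ∀ k, x ∉ bad (m + k) := by
  have htsum : ∑' k, μ (toMeasurable μ (bad k)) ≠ ⊤ := by simpa only [measure_toMeasurable]
  have hnull : μ (toMeasurable μ {x | ¬ p x}) = 0 := by rwa [measure_toMeasurable]
  refine ⟨fun m => (⋂ k, (toMeasurable μ (bad (m + k)))ᶜ) \ toMeasurable μ {x | ¬ p x},
    fun m => (MeasurableSet.iInter fun k => (measurableSet_toMeasurable _ _).compl).diff
      (measurableSet_toMeasurable _ _), ?_, fun m x hx => ⟨?_, fun k hk => ?_⟩⟩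
  · filter_upwards [ae_eventually_notMem htsum, measure_eq_zero_iff_ae_notMem.1 hnull]
      with x hx hxp
    obtain ⟨m, hm⟩ := eventually_atTop.1 hx
    exact mem_iUnion.2 ⟨m, mem_iInter.2 fun k => hm _ (Nat.le_add_right m k), hxp⟩
  · by_contra hpx
    exact hx.2 (subset_toMeasurable _ _ hpx)
  · exact mem_iInter.1 hx.1 k (subset_toMeasurable _ _ hk)

theorem hasFDerivWithinAt_of_geometric_increments {E F : Type*} [NormedAddCommGroup E]
    [NormedSpace ℝ E] [NormedAddCommGroup F] [NormedSpace ℝ F] {v : ℕ → E → F} {u : E → F}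
    {D : E →L[ℝ] F} {A : Set E} {x : E} {C : ℝ} (hv : ∀ k, DifferentiableAt ℝ (v k) x)
    (hlim : ∀ y ∈ A, Tendsto (fun k => v k y) atTop (𝓝 (u y)))
    (hD : Tendsto (fun k => fderiv ℝ (v k) x) atTop (𝓝 D)) (hx : x ∈ A)
    (hinc : ∀ y ∈ A, dist y x ≤ 1 → ∀ k,
      ‖(v (k + 1) y - v k y) - (v (k + 1) x - v k x)‖ ≤ C * ‖y - x‖ * (1 / 2) ^ k) :
    HasFDerivWithinAt u D A x := by
  have htail (k : ℕ) (y : E) (hy : y ∈ A) (hyx : dist y x ≤ 1) :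
      ‖u y - u x - (v k y - v k x)‖ ≤ C * (1 / 2) ^ k / (1 - 1 / 2) * ‖y - x‖ := by
    have hdist := dist_le_of_le_geometric_of_tendsto (1 / 2 : ℝ) (C * ‖y - x‖) (by norm_num)
      (f := fun k => v k y - v k x)
      (fun j => by rw [dist_comm, dist_eq_norm, sub_sub_sub_comm]; exact hinc y hy hyx j)
      ((hlim y hy).sub (hlim x hx)) k
    rw [dist_comm, dist_eq_norm] at hdist
    exact hdist.trans_eq (by ring)
  have htail_zero : Tendsto (fun k : ℕ => C * (1 / 2 : ℝ) ^ k / (1 - 1 / 2)) atTop (𝓝 0) := by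
    simpa using ((tendsto_pow_atTop_nhds_zero_of_lt_one (r := (1 / 2 : ℝ)) (by norm_num)
      (by norm_num)).const_mul C).div_const (1 - 1 / 2)
  rw [hasFDerivWithinAt_iff_isLittleO, Asymptotics.isLittleO_iff]
  intro ε hε
  have hε3 : 0 < ε / 3 := by positivity
  obtain ⟨k, hk_tail, hk_deriv⟩ := ((htail_zero.eventually_le_const hε3).and
    ((tendsto_iff_norm_sub_tendsto_zero.1 hD).eventually_le_const hε3)).exists
  have hvk := Asymptotics.isLittleO_iff.1 (hv k).hasFDerivAt.isLittleO hε3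
  filter_upwards [mem_nhdsWithin_of_mem_nhds hvk, self_mem_nhdsWithin,
    mem_nhdsWithin_of_mem_nhds (closedBall_mem_nhds x one_pos)] with y hy hyA hyx
  calc ‖u y - u x - D (y - x)‖
      = ‖(u y - u x - (v k y - v k x)) + (v k y - v k x - fderiv ℝ (v k) x (y - x))
          + (fderiv ℝ (v k) x - D) (y - x)‖ := by
        congr 1; rw [sub_apply]; abel
    _ ≤ ‖u y - u x - (v k y - v k x)‖ + ‖v k y - v k x - fderiv ℝ (v k) x (y - x)‖
          + ‖(fderiv ℝ (v k) x - D) (y - x)‖ := norm_add₃_le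
    _ ≤ ε / 3 * ‖y - x‖ + ε / 3 * ‖y - x‖ + ε / 3 * ‖y - x‖ := by
        gcongr
        · exact (htail k y hyA hyx).trans (by gcongr)
        · exact (le_opNorm _ _).trans (by gcongr)
    _ = ε * ‖y - x‖ := by ring

theorem exists_contDiff_cutoff {E : Type*} [NormedAddCommGroup E] [NormedSpace ℝ E]
    [FiniteDimensional ℝ E] {K Ω : Set E} (hK : IsCompact K) (hΩ : IsOpen Ω) (hKΩ : K ⊆ Ω) :
    ∃ η : E → ℝ, ContDiff ℝ ∞ η ∧ HasCompactSupport η ∧ tsupport η ⊆ Ω ∧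
      ∀ x ∈ K, η x = 1 ∧ fderiv ℝ η x = 0 := by
  obtain ⟨L, hL, hKL, hLΩ⟩ := exists_compact_between hK hΩ hKΩ
  obtain ⟨η, hη, hrange, hsupp, hone⟩ := exists_contMDiff_support_eq_eq_one_iff (n := ⊤)
    (modelWithCornersSelf ℝ E) isOpen_interior hK.isClosed hKL
  have hts : tsupport η ⊆ L := by
    rw [tsupport, hsupp]
    exact hL.isClosed.closure_interior_subset
  refine ⟨η, hη.contDiff, hL.of_isClosed_subset (isClosed_tsupport η) hts, hts.trans hLΩ,
    fun x hx => ⟨(hone x).1 hx, IsLocalMax.fderiv_eq_zero (Eventually.of_forall fun y => ?_)⟩⟩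
  rw [(hone x).1 hx]
  exact (hrange (mem_range_self y)).2

theorem exists_iUnion_isCompact_eq_of_isOpen {X : Type*} [TopologicalSpace X]
    [LocallyCompactSpace X] [SecondCountableTopology X] {U : Set X} (hU : IsOpen U) :
    ∃ K : ℕ → Set X, (∀ k, IsCompact (K k)) ∧ ⋃ k, K k = U := by
  have := hU.locallyCompactSpace
  exact isSigmaCompact_iff_sigmaCompactSpace.2 inferInstance

variable {E F : Type*} [NormedAddCommGroup E] [NormedSpace ℝ E] [FiniteDimensional ℝ E]
  [MeasurableSpace E] [BorelSpace E] {μ : Measure E} [μ.IsAddHaarMeasure]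
  [NormedAddCommGroup F] [NormedSpace ℝ F]

theorem measure_maximalSuperlevel_le_of_lintegral_le {g : E → ℝ≥0∞} {b c : ℝ≥0∞} (hc : c ≠ 0)
    (hc' : c ≠ ⊤) (hg : ∫⁻ x, g x ∂μ ≤ c * b) :
    μ (maximalSuperlevel μ g c) ≤ 5 ^ Module.finrank ℝ E * b := by
  refine (ENNReal.mul_le_mul_iff_right hc hc').1 ((mul_measure_maximalSuperlevel_le μ g c).trans ?_)
  rw [mul_left_comm]
  gcongr

variable [CompleteSpace F]

theorem exists_cover_hasFDerivWithinAt_of_tendsto {v : ℕ → E → F} {u : E → F} {g : E → E →L[ℝ] F}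
    (hv : ∀ k, ContDiff ℝ 1 (v k)) (hlim : ∀ᵐ x ∂μ, Tendsto (fun k => v k x) atTop (𝓝 (u x)))
    (hlim' : ∀ᵐ x ∂μ, Tendsto (fun k => fderiv ℝ (v k) x) atTop (𝓝 (g x)))
    {C : ℝ≥0∞} (hC : C ≠ ⊤)
    (hint : ∀ k, ∫⁻ x, ‖fderiv ℝ (v (k + 1)) x - fderiv ℝ (v k) x‖ₑ ∂μ ≤ C * 4⁻¹ ^ k) :
    ∃ A : ℕ → Set E, (∀ m, MeasurableSet (A m)) ∧ (∀ᵐ x ∂μ, x ∈ ⋃ m, A m) ∧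
      ∀ m, ∀ x ∈ A m, HasFDerivWithinAt u (g x) (A m) x := by
  set N := Module.finrank ℝ E
  set bad : ℕ → Set E := fun k =>
    maximalSuperlevel μ (fun x => ‖fderiv ℝ (v (k + 1) - v k) x‖ₑ) (2⁻¹ ^ k)
  have hquarter (k : ℕ) : (4⁻¹ : ℝ≥0∞) ^ k = 2⁻¹ ^ k * 2⁻¹ ^ k := by
    rw [← mul_pow, ← ENNReal.mul_inv (by simp) (by simp)]
    norm_num
  have hbad (k : ℕ) : μ (bad k) ≤ 5 ^ N * (C * 2⁻¹ ^ k) := by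
    refine measure_maximalSuperlevel_le_of_lintegral_le (by simp) (by simp) ?_
    simp_rw [fun x => fderiv_sub ((hv (k + 1)).differentiable one_ne_zero x)
      ((hv k).differentiable one_ne_zero x)]
    exact (hint k).trans_eq (by rw [hquarter]; ring)
  have hbad_sum : ∑' k, μ (bad k) ≠ ⊤ := by
    refine ne_top_of_le_ne_top ?_ (ENNReal.tsum_le_tsum hbad)
    rw [ENNReal.tsum_mul_left, ENNReal.tsum_mul_left, ENNReal.tsum_geometric]
    exact ENNReal.mul_ne_top (by simp) (ENNReal.mul_ne_top hC (by simp))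
  obtain ⟨A, hA, hcover, hgood⟩ := exists_measurableSet_cover_of_tsum_ne_top hbad_sum
    (hlim.and hlim')
  refine ⟨A, hA, hcover, fun m x hx => ?_⟩
  have hshift : Tendsto (fun k => m + k) atTop atTop :=
    tendsto_atTop_mono (Nat.le_add_left · m) tendsto_id
  refine hasFDerivWithinAt_of_geometric_increments (v := fun k => v (m + k))
    (C := 2 ^ (N + 1) * (1 / 2) ^ m) (fun k => (hv _).differentiable one_ne_zero x)
    (fun y hy => (hgood m y hy).1.1.comp hshift) ((hgood m x hx).1.2.comp hshift) hx
    fun y hy hyx k => ?_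
  have hlip := enorm_sub_le_of_notMem_maximalSuperlevel μ ((hv (m + k + 1)).sub (hv (m + k)))
    ((hgood m x hx).2 k) ((hgood m y hy).2 k) hyx
  have hlip_real := ENNReal.toReal_mono (by finiteness) hlip
  simp only [toReal_enorm, ENNReal.toReal_mul, ENNReal.toReal_pow, ENNReal.toReal_ofNat,
    ENNReal.toReal_inv] at hlip_real
  exact hlip_real.trans_eq (by rw [one_div, pow_add (2⁻¹ : ℝ)]; ring)

namespace HasWeakFDerivOn

variable {Ω : Set E} {u : E → F} {g : E → E →L[ℝ] F}

theorem exists_cover_hasFDerivWithinAt_of_integrable (h : HasWeakFDerivOn μ univ u g)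
    (hg : Integrable g μ) :
    ∃ A : ℕ → Set E, (∀ m, MeasurableSet (A m)) ∧ (∀ᵐ x ∂μ, x ∈ ⋃ m, A m) ∧
      ∀ m, ∀ x ∈ A m, HasFDerivWithinAt u (g x) (A m) x := by
  have hu : LocallyIntegrable u μ := locallyIntegrableOn_univ.1 h.locallyIntegrableOn
  obtain ⟨n, hn, hnle⟩ := extraction_forall_of_eventually (P := fun k j =>
      ∫⁻ x, ‖mollify μ g j x - g x‖ₑ ∂μ ≤ (4⁻¹ : ℝ≥0∞) ^ k) fun k =>
    (tendsto_lintegral_enorm_mollify_sub hg).eventually_le_const (ENNReal.pow_pos (by simp) k)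
  have hfderiv (k : ℕ) (x : E) : fderiv ℝ (mollify μ u k) x = mollify μ g k x :=
    (h.hasFDerivAt_mollify k x).fderiv
  have hg_meas (k : ℕ) : AEStronglyMeasurable (mollify μ g k) μ :=
    (contDiff_mollify hg.locallyIntegrable 0 k).continuous.aestronglyMeasurable
  refine exists_cover_hasFDerivWithinAt_of_tendsto (v := fun k => mollify μ u (n k)) (C := 2)
    (fun k => contDiff_mollify hu 1 (n k))
    ((ae_tendsto_mollify hu).mono fun x hx => hx.comp hn.tendsto_atTop) ?_ (by simp) fun k => ?_
  · simp only [hfderiv]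
    exact (ae_tendsto_mollify hg.locallyIntegrable).mono fun x hx => hx.comp hn.tendsto_atTop
  · simp only [hfderiv]
    calc ∫⁻ x, ‖mollify μ g (n (k + 1)) x - mollify μ g (n k) x‖ₑ ∂μ
        ≤ ∫⁻ x, (‖mollify μ g (n (k + 1)) x - g x‖ₑ + ‖mollify μ g (n k) x - g x‖ₑ) ∂μ := by
          refine lintegral_mono fun x => ?_
          rw [← sub_sub_sub_cancel_right _ _ (g x)]
          exact enorm_sub_le
      _ = ∫⁻ x, ‖mollify μ g (n (k + 1)) x - g x‖ₑ ∂μ + ∫⁻ x, ‖mollify μ g (n k) x - g x‖ₑ ∂μ :=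
          lintegral_add_left' ((hg_meas _).sub hg.aestronglyMeasurable).enorm _
      _ ≤ 4⁻¹ ^ (k + 1) + 4⁻¹ ^ k := add_le_add (hnle (k + 1)) (hnle k)
      _ ≤ 4⁻¹ ^ k + 4⁻¹ ^ k := by
          gcongr ?_ + _
          exact pow_le_pow_of_le_one zero_le (by simp) (Nat.le_succ k)
      _ = 2 * 4⁻¹ ^ k := (two_mul _).symm

theorem exists_cover_hasFDerivWithinAt_of_isCompact (h : HasWeakFDerivOn μ Ω u g)
    (hΩ : IsOpen Ω) {K : Set E} (hK : IsCompact K) (hKΩ : K ⊆ Ω) :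
    ∃ A : ℕ → Set E, (∀ m, MeasurableSet (A m)) ∧ (∀ m, A m ⊆ K) ∧
      (∀ᵐ x ∂μ, x ∈ K → x ∈ ⋃ m, A m) ∧
      ∀ m, ∀ x ∈ A m, HasFDerivWithinAt u (g x) (A m) x := by
  obtain ⟨η, hη, hηs, hηΩ, hone⟩ := exists_contDiff_cutoff hK hΩ hKΩ
  obtain ⟨A, hA, hcover, hderiv⟩ :=
    (h.smul_of_tsupport_subset hη hηs hηΩ).exists_cover_hasFDerivWithinAt_of_integrable
      (h.integrable_deriv_smul (hη.of_le (by simp)) hηs hηΩ)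
  refine ⟨fun m => A m ∩ K, fun m => (hA m).inter hK.measurableSet, fun m => inter_subset_right,
    ?_, fun m x hx => ?_⟩
  · filter_upwards [hcover] with x hx hxK
    exact iUnion_inter K A ▸ ⟨hx, hxK⟩
  · have hderiv_x := (hderiv m x hx.1).mono (inter_subset_left : A m ∩ K ⊆ A m)
    have hg_x : η x • g x + (fderiv ℝ η x).smulRight (u x) = g x := by
      ext w
      simp [hone x hx.2]
    rw [hg_x] at hderiv_x
    exact hderiv_x.congr (fun y hy => by simp [hone y hy.2]) (by simp [hone x hx.2])

theorem exists_cover_hasFDerivWithinAt (h : HasWeakFDerivOn μ Ω u g) (hΩ : IsOpen Ω) :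
    ∃ A : ℕ → Set E, (∀ m, MeasurableSet (A m)) ∧ (∀ m, A m ⊆ Ω) ∧
      (∀ᵐ x ∂μ, x ∈ Ω → x ∈ ⋃ m, A m) ∧
      ∀ m, ∀ x ∈ A m, HasFDerivWithinAt u (g x) (A m) x := by
  obtain ⟨K, hK, rfl⟩ := exists_iUnion_isCompact_eq_of_isOpen hΩ
  choose A hA hAK hcover hderiv using fun k =>
    h.exists_cover_hasFDerivWithinAt_of_isCompact hΩ (hK k) (subset_iUnion K k)
  refine ⟨fun m => A m.unpair.1 m.unpair.2, fun m => hA _ _,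
    fun m => (hAK _ _).trans (subset_iUnion K _), ?_, fun m => hderiv _ _⟩
  filter_upwards [ae_all_iff.2 hcover] with x hx hxΩ
  obtain ⟨k, hk⟩ := mem_iUnion.1 hxΩ
  obtain ⟨m, hm⟩ := mem_iUnion.1 (hx k hk)
  exact mem_iUnion.2 ⟨Nat.pair k m, by simpa using hm⟩

end HasWeakFDerivOn

end ApproximateDifferentiability

section Matrices

open ContinuousLinearMap

section MatrixVec

variable {ι κ : Type*}

/-- The vector of entries of a matrix. It carries the Frobenius norm to the Euclidean one, and so
gives access to the inner product behind the Frobenius norm. -/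
noncomputable def matrixVec : Matrix ι κ ℝ ≃ₗ[ℝ] EuclideanSpace ℝ (ι × κ) :=
  (Matrix.ofLinearEquiv ℝ).symm ≪≫ₗ (LinearEquiv.curry ℝ ℝ ι κ).symm ≪≫ₗ
    (WithLp.linearEquiv 2 ℝ (ι × κ → ℝ)).symm

theorem matrixVec_apply (A : Matrix ι κ ℝ) (p : ι × κ) : matrixVec A p = A p.1 p.2 :=
  rfl

theorem tsupport_entry_subset {X : Type*} [TopologicalSpace X] (φ : X → Matrix ι κ ℝ) (i : ι)
    (j : κ) : tsupport (fun x => φ x i j) ⊆ tsupport φ :=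
  closure_mono fun x hx hφx => hx (by simp only [hφx, Matrix.zero_apply])

variable [Fintype ι] [Fintype κ]

theorem norm_matrixVec (A : Matrix ι κ ℝ) : ‖matrixVec A‖ = ‖A‖ := by
  simp only [EuclideanSpace.norm_eq, Matrix.frobenius_norm_def, Real.sqrt_eq_rpow,
    Fintype.sum_prod_type, matrixVec_apply, Real.rpow_ofNat]

theorem enorm_matrixVec (A : Matrix ι κ ℝ) : ‖matrixVec A‖ₑ = ‖A‖ₑ := by
  rw [← ofReal_norm, ← ofReal_norm, norm_matrixVec]

theorem inner_matrixVec (A B : Matrix ι κ ℝ) :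
    inner ℝ (matrixVec A) (matrixVec B) = ∑ i, ∑ j, A i j * B i j := by
  simp only [PiLp.inner_apply, Fintype.sum_prod_type, matrixVec_apply, RCLike.inner_apply,
    conj_trivial, mul_comm]

end MatrixVec

theorem locallyIntegrableOn_piLp {X ι : Type*} [TopologicalSpace X] [MeasurableSpace X]
    [Fintype ι] {E : ι → Type*} [∀ i, NormedAddCommGroup (E i)] {q : ℝ≥0∞} [Fact (1 ≤ q)]
    {μ : Measure X} {Ω : Set X} {D : X → PiLp q E}
    (hD : ∀ i, LocallyIntegrableOn (fun x => D x i) Ω μ) : LocallyIntegrableOn D Ω μ := by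
  intro x hx
  choose t ht hDt using fun i => hD i x hx
  exact ⟨⋂ i, t i, Filter.iInter_mem.2 ht,
    Integrable.of_eval_piLp fun i => (hDt i).mono_set (iInter_subset t i)⟩

variable {n d : ℕ}

/-- The continuous linear maps `ℝⁿ → ℝᵈ` are the `d × n` matrices. -/
noncomputable def matrixCLM : Matrix (Fin d) (Fin n) ℝ ≃ₗ[ℝ] Rn n →L[ℝ] Rn d :=
  Matrix.toEuclideanLin ≪≫ₗ LinearMap.toContinuousLinearMap

theorem matrixCLM_single_apply (A : Matrix (Fin d) (Fin n) ℝ) (i : Fin d) (j : Fin n) :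
    matrixCLM A (EuclideanSpace.single j 1) i = A i j :=
  congrFun (Matrix.mulVec_single_one A j) i

theorem det_matrixCLM (A : Matrix (Fin n) (Fin n) ℝ) : (matrixCLM A).det = A.det := by
  change LinearMap.det (Matrix.toLpLin 2 2 A) = A.det
  rw [Matrix.toLpLin_eq_toLin, LinearMap.det_toLin]

theorem tsupport_partialDeriv_subset (j : Fin n) (φ : Rn n → ℝ) :
    tsupport (partialDeriv j φ) ⊆ tsupport φ :=
  tsupport_fderiv_apply_subset ℝ _

namespace HasLocSobolevDeriv

variable {Ω : Set (Rn n)} {u : Rn n → Rn d} {Du : Rn n → Matrix (Fin d) (Fin n) ℝ}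

theorem locallyIntegrableOn_matrixVec (h : HasLocSobolevDeriv Ω u Du) :
    LocallyIntegrableOn (fun x => matrixVec (Du x)) Ω volume :=
  locallyIntegrableOn_piLp fun p => h.locallyIntegrableOn_deriv p.1 p.2

theorem locallyIntegrableOn_matrixCLM (h : HasLocSobolevDeriv Ω u Du) :
    LocallyIntegrableOn (fun x => matrixCLM (Du x)) Ω volume := by
  let T : EuclideanSpace ℝ (Fin d × Fin n) →L[ℝ] Rn n →L[ℝ] Rn d :=
    (matrixCLM.toLinearMap ∘ₗ matrixVec.symm.toLinearMap).toContinuousLinearMap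
  have hT : (fun x => matrixCLM (Du x)) = T ∘ fun x => matrixVec (Du x) :=
    funext fun x => congrArg matrixCLM (matrixVec.symm_apply_apply (Du x)).symm
  rw [hT]
  exact T.locallyIntegrableOn_comp h.locallyIntegrableOn_matrixVec

theorem hasWeakFDerivOn (h : HasLocSobolevDeriv Ω u Du) :
    HasWeakFDerivOn volume Ω u (fun x => matrixCLM (Du x)) where
  locallyIntegrableOn := h.locallyIntegrableOn
  locallyIntegrableOn_deriv := h.locallyIntegrableOn_matrixCLM
  integral_fderiv_smul φ hφ hφs hφΩ w := by
    have hint_u : Integrable fun x => (fderiv ℝ φ x).smulRight (u x) :=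
      integrable_bilin_of_tsupport_subset (smulRightL ℝ (Rn n) (Rn d))
        (hφ.continuous_fderiv (by simp)) (hφs.fderiv ℝ) ((tsupport_fderiv_subset ℝ).trans hφΩ)
        h.locallyIntegrableOn
    have hint_Du : Integrable fun x => φ x • matrixCLM (Du x) :=
      integrable_bilin_of_tsupport_subset (lsmul ℝ ℝ) hφ.continuous hφs hφΩ
        h.locallyIntegrableOn_matrixCLM
    suffices hop : ∫ x, (fderiv ℝ φ x).smulRight (u x) = - ∫ x, φ x • matrixCLM (Du x) by
      simpa only [ContinuousLinearMap.integral_apply hint_u, neg_apply, smulRight_apply,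
        ContinuousLinearMap.integral_apply hint_Du, smul_apply] using congrArg (· w) hop
    refine coe_injective ((EuclideanSpace.basisFun (Fin n) ℝ).toBasis.ext fun j => ?_)
    ext i
    have hentry {T : Rn n → Rn n →L[ℝ] Rn d} (hT : Integrable T) :
        (∫ x, T x) (EuclideanSpace.single j 1) i = ∫ x, T x (EuclideanSpace.single j 1) i :=
      (((EuclideanSpace.proj (𝕜 := ℝ) i).comp
        (apply ℝ (Rn d) (EuclideanSpace.single j 1))).integral_comp_comm hT).symm
    have htest := h.integral_mul_partialDeriv i j φ hφ hφs hφΩ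
    rw [setIntegral_eq_integral_of_forall_compl_eq_zero,
      setIntegral_eq_integral_of_forall_compl_eq_zero] at htest
    · simpa [hentry hint_u, hentry hint_Du, matrixCLM_single_apply, partialDeriv, mul_comm]
        using htest
    · exact fun x hx => by rw [image_eq_zero_of_notMem_tsupport fun hx' => hx (hφΩ hx'), mul_zero]
    · exact fun x hx => by
        rw [image_eq_zero_of_notMem_tsupport fun hx' =>
          hx (hφΩ (tsupport_partialDeriv_subset j φ hx')), mul_zero]

theorem locallyIntegrableOn_apply (h : HasLocSobolevDeriv Ω u Du) (i : Fin d) :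
    LocallyIntegrableOn (fun x => u x i) Ω volume :=
  (EuclideanSpace.proj (𝕜 := ℝ) i).locallyIntegrableOn_comp h.locallyIntegrableOn

theorem integrable_mul_partialDeriv (h : HasLocSobolevDeriv Ω u Du) {φ : Rn n → ℝ}
    (hφ : ContDiff ℝ 1 φ) (hφs : HasCompactSupport φ) (hφΩ : tsupport φ ⊆ Ω) (i : Fin d)
    (j : Fin n) : Integrable fun x => u x i * partialDeriv j φ x := by
  simp_rw [mul_comm (u _ i)]
  exact integrable_bilin_of_tsupport_subset (mul ℝ ℝ)
    ((hφ.continuous_fderiv one_ne_zero).clm_apply continuous_const) (hφs.fderiv_apply ℝ _)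
    ((tsupport_partialDeriv_subset j φ).trans hφΩ) (h.locallyIntegrableOn_apply i)

theorem integrable_mul_deriv (h : HasLocSobolevDeriv Ω u Du) {φ : Rn n → ℝ}
    (hφ : Continuous φ) (hφs : HasCompactSupport φ) (hφΩ : tsupport φ ⊆ Ω) (i : Fin d)
    (j : Fin n) : Integrable fun x => φ x * Du x i j :=
  integrable_bilin_of_tsupport_subset (mul ℝ ℝ) hφ hφs hφΩ (h.locallyIntegrableOn_deriv i j)

theorem integral_mul_partialDeriv_of_contDiff_one (h : HasLocSobolevDeriv Ω u Du)
    (hΩ : IsOpen Ω) {φ : Rn n → ℝ} (hφ : ContDiff ℝ 1 φ) (hφs : HasCompactSupport φ)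
    (hφΩ : tsupport φ ⊆ Ω) (i : Fin d) (j : Fin n) :
    ∫ x, u x i * partialDeriv j φ x = - ∫ x, φ x * Du x i j := by
  have hweak : ∫ x, partialDeriv j φ x • u x =
      - ∫ x, φ x • matrixCLM (Du x) (EuclideanSpace.single j 1) :=
    h.hasWeakFDerivOn.integral_fderiv_smul_of_contDiff_one hΩ hφ hφs hφΩ _
  have hint : Integrable fun x => partialDeriv j φ x • u x :=
    integrable_bilin_of_tsupport_subset (lsmul ℝ ℝ)
      ((hφ.continuous_fderiv one_ne_zero).clm_apply continuous_const) (hφs.fderiv_apply ℝ _)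
      ((tsupport_partialDeriv_subset j φ).trans hφΩ) h.locallyIntegrableOn
  have hint_Du : Integrable fun x => φ x • matrixCLM (Du x) (EuclideanSpace.single j 1) :=
    (integrable_bilin_of_tsupport_subset (lsmul ℝ ℝ) hφ.continuous hφs hφΩ
      h.locallyIntegrableOn_matrixCLM).apply_continuousLinearMap _
  have hi := congrArg (fun v : Rn d => v i) hweak
  rw [PiLp.neg_apply, eval_integral_piLp fun i => hint.eval_piLp i,
    eval_integral_piLp fun i => hint_Du.eval_piLp i] at hi
  simpa only [PiLp.smul_apply, smul_eq_mul, matrixCLM_single_apply, mul_comm] using hi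

end HasLocSobolevDeriv

end Matrices

section TotalVariation

open Filter Topology

section Duality

variable {E V : Type*} [NormedAddCommGroup E] [NormedSpace ℝ E] [FiniteDimensional ℝ E]
  [MeasurableSpace E] [BorelSpace E] {μ : Measure E} [μ.IsAddHaarMeasure]
  [NormedAddCommGroup V] [InnerProductSpace ℝ V]

theorem exists_norm_le_one_integral_inner_eq {α : Type*} [MeasurableSpace α] {ν : Measure α}
    {s : Set α} {D : α → V} (hs : MeasurableSet s) (hD : AEStronglyMeasurable D (ν.restrict s)) :
    ∃ ψ : α → V, AEStronglyMeasurable ψ ν ∧ (∀ x, ‖ψ x‖ ≤ 1) ∧ (∀ x ∉ s, ψ x = 0) ∧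
      ∫ x, inner ℝ (ψ x) (D x) ∂ν = ∫ x in s, ‖D x‖ ∂ν := by
  refine ⟨s.indicator fun x => ‖D x‖⁻¹ • D x, ?_, fun x => ?_,
    fun x hx => indicator_of_notMem hx _, ?_⟩
  · rw [aestronglyMeasurable_indicator_iff hs]
    exact hD.norm.aemeasurable.inv.aestronglyMeasurable.smul hD
  · refine (norm_indicator_le_norm_self _ x).trans ?_
    rw [norm_smul, norm_inv, norm_norm]
    exact inv_mul_le_one
  · rw [← integral_indicator hs]
    congr 1 with x
    by_cases hx : x ∈ s
    · rw [indicator_of_mem hx, indicator_of_mem hx, real_inner_smul_left,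
        real_inner_self_eq_norm_sq, pow_two, ← mul_assoc, inv_mul_mul_self]
    · rw [indicator_of_notMem hx, indicator_of_notMem hx, inner_zero_left]

theorem setLIntegral_enorm_le_of_isCompact_of_forall_contDiff [CompleteSpace V] {K G : Set E}
    {D : E → V} (hK : IsCompact K) (hG : IsOpen G) (hKG : K ⊆ G)
    (hD : LocallyIntegrableOn D G μ) {c : ℝ≥0∞}
    (hc : ∀ ψ : E → V, ContDiff ℝ ∞ ψ → HasCompactSupport ψ → tsupport ψ ⊆ G →
      (∀ x, ‖ψ x‖ ≤ 1) → ENNReal.ofReal (∫ x, inner ℝ (ψ x) (D x) ∂μ) ≤ c) :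
    ∫⁻ x in K, ‖D x‖ₑ ∂μ ≤ c := by
  have hDK : IntegrableOn D K μ := hD.integrableOn_compact_subset hKG hK
  obtain ⟨ψ, hψ, hψ1, hψK, hψD⟩ :=
    exists_norm_le_one_integral_inner_eq hK.measurableSet hDK.aestronglyMeasurable
  have hψi : Integrable ψ μ := integrable_of_norm_le_of_isCompact hψ hψ1 hK hψK
  have hlim : Tendsto (fun k => ∫ x, inner ℝ (mollify μ ψ k x) (D x) ∂μ) atTop
      (𝓝 (∫ x, inner ℝ (ψ x) (D x) ∂μ)) :=
    tendsto_integral_bilin_mollify (innerSL ℝ) hK hG hKG hψ hψ1 hψK hD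
  rw [← ofReal_integral_norm_eq_lintegral_enorm hDK, ← hψD]
  refine le_of_tendsto (ENNReal.tendsto_ofReal hlim) ?_
  filter_upwards [eventually_cthickening_rOut_subset hK hG hKG] with k hk
  have hsupp := tsupport_mollify_subset (μ := μ) hψK k
  exact hc _ (contDiff_mollify hψi.locallyIntegrable ⊤ k)
    (hK.cthickening.of_isClosed_subset (isClosed_tsupport _) hsupp) (hsupp.trans hk)
    (norm_mollify_le hψ1 k)

theorem setLIntegral_enorm_le_of_forall_contDiff [CompleteSpace V] {G : Set E} {D : E → V}
    (hG : IsOpen G) (hD : LocallyIntegrableOn D G μ) {c : ℝ≥0∞}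
    (hc : ∀ ψ : E → V, ContDiff ℝ ∞ ψ → HasCompactSupport ψ → tsupport ψ ⊆ G →
      (∀ x, ‖ψ x‖ ≤ 1) → ENNReal.ofReal (∫ x, inner ℝ (ψ x) (D x) ∂μ) ≤ c) :
    ∫⁻ x in G, ‖D x‖ₑ ∂μ ≤ c := by
  obtain ⟨K, hK, hKG⟩ := exists_iUnion_isCompact_eq_of_isOpen hG
  have hacc : ⋃ k, accumulate K k = G := by rw [iUnion_accumulate, hKG]
  rw [← hacc, setLIntegral_iUnion_of_directed _ (monotone_accumulate.directed_le)]
  exact iSup_le fun k => setLIntegral_enorm_le_of_isCompact_of_forall_contDiff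
    (isCompact_accumulate hK k) hG (hacc ▸ subset_iUnion _ k) hD hc

theorem exists_isOpen_setLIntegral_enorm_le_add {X F : Type*} [TopologicalSpace X]
    [TopologicalSpace.PseudoMetrizableSpace X] [SecondCountableTopology X]
    [MeasurableSpace X] [BorelSpace X] [NormedAddCommGroup F]
    {ν : Measure X} {s Ω : Set X} {D : X → F} (hΩ : IsOpen Ω)
    (hD : LocallyIntegrableOn D Ω ν) (hs : MeasurableSet s) (hsΩ : s ⊆ Ω)
    {ε : ℝ≥0∞} (hε : ε ≠ 0) :
    ∃ U, IsOpen U ∧ s ⊆ U ∧ U ⊆ Ω ∧ ∫⁻ x in U, ‖D x‖ₑ ∂ν ≤ ∫⁻ x in s, ‖D x‖ₑ ∂ν + ε := by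
  let κ : Measure Ω := (ν.comap (↑)).withDensity fun x => ‖D x‖ₑ
  have hκ {t : Set Ω} (ht : MeasurableSet t) : κ t = ∫⁻ x in (↑) '' t, ‖D x‖ₑ ∂ν := by
    rw [withDensity_apply _ ht, setLIntegral_subtype hΩ.measurableSet t fun x => ‖D x‖ₑ]
  have : IsLocallyFiniteMeasure κ := ⟨fun x => by
    obtain ⟨t, ht, hDt⟩ := hD x x.2
    obtain ⟨V, hVt, hV, hxV⟩ := mem_nhds_iff.1 (preimage_coe_mem_nhds_subtype.2 ht)
    refine ⟨V, hV.mem_nhds hxV, ?_⟩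
    rw [hκ hV.measurableSet]
    exact (lintegral_mono_set (image_subset_iff.2 hVt)).trans_lt hDt.hasFiniteIntegral⟩
  obtain ⟨U, hsU, hU, hUε⟩ := ((↑) ⁻¹' s : Set Ω).exists_isOpen_le_add κ hε
  refine ⟨(↑) '' U, hΩ.isOpenMap_subtype_val U hU, fun x hx => ⟨⟨x, hsΩ hx⟩, hsU hx, rfl⟩,
    Subtype.coe_image_subset Ω U, ?_⟩
  rwa [hκ hU.measurableSet, hκ (measurable_subtype_coe hs), Subtype.image_preimage_coe,
    inter_eq_right.2 hsΩ] at hUε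

end Duality

variable {n d : ℕ} {Ω G : Set (Rn n)} {u : Rn n → Rn d}
  {Du φ : Rn n → Matrix (Fin d) (Fin n) ℝ}

namespace IsTestField

theorem hasCompactSupport_entry (hφ : IsTestField G φ) (i : Fin d) (j : Fin n) :
    HasCompactSupport fun x => φ x i j :=
  hφ.hasCompactSupport.of_isClosed_subset (isClosed_tsupport _) (tsupport_entry_subset φ i j)

theorem tsupport_entry_subset_of_subset (hφ : IsTestField G φ) (hG : G ⊆ Ω) (i : Fin d)
    (j : Fin n) : tsupport (fun x => φ x i j) ⊆ Ω :=
  (tsupport_entry_subset φ i j).trans (hφ.tsupport_subset.trans hG)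

theorem sum_partialDeriv_eq_zero_of_notMem (hφ : IsTestField G φ) {x : Rn n} (hx : x ∉ G)
    (i : Fin d) : ∑ j, partialDeriv j (fun y => φ y i j) x = 0 :=
  Finset.sum_eq_zero fun j _ => image_eq_zero_of_notMem_tsupport fun hxj =>
    hx (hφ.tsupport_entry_subset_of_subset Subset.rfl i j (tsupport_partialDeriv_subset j _ hxj))

theorem enorm_inner_matrixVec_le (hφ : IsTestField G φ) (A : Rn n → Matrix (Fin d) (Fin n) ℝ)
    (x : Rn n) :
    ‖inner ℝ (matrixVec (φ x)) (matrixVec (A x))‖ₑ ≤ G.indicator (fun x => ‖A x‖ₑ) x := by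
  by_cases hx : x ∈ G
  · rw [indicator_of_mem hx, ← ofReal_norm, ← ofReal_norm]
    refine ENNReal.ofReal_le_ofReal ((norm_inner_le_norm _ _).trans ?_)
    rw [norm_matrixVec, norm_matrixVec]
    exact mul_le_of_le_one_left (norm_nonneg _) (hφ.norm_le_one x)
  · rw [indicator_of_notMem hx, image_eq_zero_of_notMem_tsupport fun hxφ =>
      hx (hφ.tsupport_subset hxφ), map_zero, inner_zero_left, enorm_zero]

end IsTestField

theorem isTestField_matrixVec_symm {ψ : Rn n → EuclideanSpace ℝ (Fin d × Fin n)}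
    (hψ : ContDiff ℝ 1 ψ) (hψs : HasCompactSupport ψ) (hψG : tsupport ψ ⊆ G)
    (hψ1 : ∀ x, ‖ψ x‖ ≤ 1) : IsTestField G fun x => matrixVec.symm (ψ x) := by
  have hsupp : tsupport (fun x => matrixVec.symm (ψ x)) ⊆ tsupport ψ :=
    closure_mono fun x hx hψx => hx (by simp only [hψx, map_zero])
  exact ⟨fun i j => (EuclideanSpace.proj (𝕜 := ℝ) (i, j)).contDiff.comp hψ,
    hψs.of_isClosed_subset (isClosed_tsupport _) hsupp, hsupp.trans hψG,
    fun x => by rw [← norm_matrixVec, LinearEquiv.apply_symm_apply]; exact hψ1 x⟩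

namespace HasLocSobolevDeriv

theorem sum_integral_mul_div_eq (h : HasLocSobolevDeriv Ω u Du) (hΩ : IsOpen Ω) (hG : G ⊆ Ω)
    (hφ : IsTestField G φ) :
    ∑ i, ∫ x in G, u x i * ∑ j, partialDeriv j (fun y => φ y i j) x =
      - ∫ x, inner ℝ (matrixVec (φ x)) (matrixVec (Du x)) := by
  have hφs := hφ.hasCompactSupport_entry
  have hφΩ := hφ.tsupport_entry_subset_of_subset hG
  have hint (i : Fin d) (j : Fin n) : Integrable fun x => φ x i j * Du x i j :=
    h.integrable_mul_deriv (hφ.contDiff i j).continuous (hφs i j) (hφΩ i j) i j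
  simp only [inner_matrixVec]
  rw [integral_finsetSum _ fun i _ => integrable_finsetSum _ fun j _ => hint i j,
    ← Finset.sum_neg_distrib]
  refine Finset.sum_congr rfl fun i _ => ?_
  rw [setIntegral_eq_integral_of_forall_compl_eq_zero fun x hx => by
      rw [hφ.sum_partialDeriv_eq_zero_of_notMem hx, mul_zero],
    integral_finsetSum _ fun j _ => hint i j, ← Finset.sum_neg_distrib]
  simp only [Finset.mul_sum]
  rw [integral_finsetSum _ fun j _ =>
    h.integrable_mul_partialDeriv (hφ.contDiff i j) (hφs i j) (hφΩ i j) i j]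
  exact Finset.sum_congr rfl fun j _ =>
    h.integral_mul_partialDeriv_of_contDiff_one hΩ (hφ.contDiff i j) (hφs i j) (hφΩ i j) i j

theorem openVariation_le_lintegral (h : HasLocSobolevDeriv Ω u Du) (hΩ : IsOpen Ω) (hG : G ⊆ Ω) :
    openVariation u G ≤ ∫⁻ x in G, ‖Du x‖ₑ := by
  refine iSup₂_le fun φ hφ => ?_
  calc ENNReal.ofReal (∑ i, ∫ x in G, u x i * ∑ j, partialDeriv j (fun y => φ y i j) x)
      = ENNReal.ofReal (- ∫ x, inner ℝ (matrixVec (φ x)) (matrixVec (Du x))) := by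
        rw [h.sum_integral_mul_div_eq hΩ hG hφ]
    _ ≤ ‖∫ x, inner ℝ (matrixVec (φ x)) (matrixVec (Du x))‖ₑ := by
        rw [← ofReal_norm]
        exact ENNReal.ofReal_le_ofReal (neg_le_abs _)
    _ ≤ ∫⁻ x, ‖inner ℝ (matrixVec (φ x)) (matrixVec (Du x))‖ₑ :=
        enorm_integral_le_lintegral_enorm _
    _ ≤ ∫⁻ x, G.indicator (fun x => ‖Du x‖ₑ) x :=
        lintegral_mono (hφ.enorm_inner_matrixVec_le Du)
    _ ≤ ∫⁻ x in G, ‖Du x‖ₑ := lintegral_indicator_le _ _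

theorem lintegral_le_openVariation (h : HasLocSobolevDeriv Ω u Du) (hΩ : IsOpen Ω) (hGo : IsOpen G)
    (hG : G ⊆ Ω) : ∫⁻ x in G, ‖Du x‖ₑ ≤ openVariation u G := by
  simp_rw [← enorm_matrixVec]
  refine setLIntegral_enorm_le_of_forall_contDiff hGo (h.locallyIntegrableOn_matrixVec.mono_set hG)
    fun ψ hψ hψs hψG hψ1 => ?_
  have hφ : IsTestField G fun x => matrixVec.symm (-ψ x) :=
    isTestField_matrixVec_symm (hψ.neg.of_le (by simp)) hψs.neg
      ((tsupport_neg ψ).subset.trans hψG) (by simpa)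
  refine le_iSup₂_of_le _ hφ (ENNReal.ofReal_le_ofReal ?_)
  rw [h.sum_integral_mul_div_eq hΩ hG hφ, ← integral_neg]
  simp only [LinearEquiv.apply_symm_apply, inner_neg_left, neg_neg, le_refl]

theorem openVariation_eq (h : HasLocSobolevDeriv Ω u Du) (hΩ : IsOpen Ω) (hGo : IsOpen G)
    (hG : G ⊆ Ω) : openVariation u G = ∫⁻ x in G, ‖Du x‖ₑ :=
  (h.openVariation_le_lintegral hΩ hG).antisymm (h.lintegral_le_openVariation hΩ hGo hG)

theorem totalVariation_eq (h : HasLocSobolevDeriv Ω u Du) (hΩ : IsOpen Ω) {E : Set (Rn n)}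
    (hE : MeasurableSet E) (hEΩ : E ⊆ Ω) : totalVariation Ω u E = ∫⁻ x in E, ‖Du x‖ₑ := by
  apply le_antisymm
  · refine ENNReal.le_of_forall_pos_le_add fun ε hε _ => ?_
    obtain ⟨G, hGo, hEG, hG, hGε⟩ := exists_isOpen_setLIntegral_enorm_le_add hΩ
      h.locallyIntegrableOn_matrixVec hE hEΩ (ENNReal.coe_pos.2 hε).ne'
    simp only [enorm_matrixVec] at hGε
    rw [← h.openVariation_eq hΩ hGo hG] at hGε
    exact (iInf₂_le_of_le G hGo (iInf₂_le hEG hG)).trans hGε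
  · refine le_iInf₂ fun G hGo => le_iInf₂ fun hEG hG => ?_
    rw [h.openVariation_eq hΩ hGo hG]
    exact lintegral_mono_set hEG

end HasLocSobolevDeriv

end TotalVariation

section AreaFormula

theorem HasWeakFDerivOn.aemeasurable_abs_det {E : Type*} [NormedAddCommGroup E] [NormedSpace ℝ E]
    [FiniteDimensional ℝ E] [MeasurableSpace E] {μ : Measure E} {Ω : Set E}
    {f : E → E} {f' : E → E →L[ℝ] E} (h : HasWeakFDerivOn μ Ω f f') :
    AEMeasurable (fun x => |(f' x).det|) (μ.restrict Ω) :=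
  (ContinuousLinearMap.continuous_det.abs.comp_aestronglyMeasurable
    h.locallyIntegrableOn_deriv.aestronglyMeasurable).aemeasurable

variable {E : Type*} [NormedAddCommGroup E] [NormedSpace ℝ E] [FiniteDimensional ℝ E]
  [MeasurableSpace E] [BorelSpace E] {μ : Measure E} [μ.IsAddHaarMeasure]
  {f : E → E} {f' : E → E →L[ℝ] E}

theorem measurableSet_image_and_lintegral_image_eq_of_cover {A : ℕ → Set E}
    (hA : ∀ m, MeasurableSet (A m)) (hf' : ∀ m, ∀ x ∈ A m, HasFDerivWithinAt f (f' x) (A m) x)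
    {s : Set E} (hs : MeasurableSet s) (hsA : s ⊆ ⋃ m, A m) (hf : InjOn f s) :
    MeasurableSet (f '' s) ∧ ∀ g : E → ℝ≥0∞,
      ∫⁻ y in f '' s, g y ∂μ = ∫⁻ x in s, ENNReal.ofReal |(f' x).det| * g (f x) ∂μ := by
  let B (m : ℕ) : Set E := s ∩ disjointed A m
  have hB (m : ℕ) : MeasurableSet (B m) := hs.inter (MeasurableSet.disjointed hA m)
  have hBs (m : ℕ) : B m ⊆ s := inter_subset_left
  have hBA (m : ℕ) : B m ⊆ A m := inter_subset_right.trans (disjointed_subset A m)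
  have hBU : ⋃ m, B m = s := by
    rw [← inter_iUnion, iUnion_disjointed, inter_eq_left.2 hsA]
  have hBd : Pairwise (Function.onFun Disjoint B) := fun i j hij =>
    (disjoint_disjointed A hij).mono inter_subset_right inter_subset_right
  have hBf' (m : ℕ) : ∀ x ∈ B m, HasFDerivWithinAt f (f' x) (B m) x := fun x hx =>
    (hf' m x (hBA m hx)).mono (hBA m)
  have hfB (m : ℕ) : MeasurableSet (f '' B m) :=
    measurable_image_of_fderivWithin (hB m) (hBf' m) (hf.mono (hBs m))
  have hfBd : Pairwise (Function.onFun Disjoint fun m => f '' B m) := fun i j hij => by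
    rw [Function.onFun, disjoint_iff_inter_eq_empty, ← hf.image_inter (hBs i) (hBs j),
      (hBd hij).inter_eq, image_empty]
  constructor
  · rw [← hBU, image_iUnion]
    exact MeasurableSet.iUnion hfB
  · intro g
    rw [← hBU, image_iUnion, lintegral_iUnion hfB hfBd, lintegral_iUnion hB hBd]
    exact tsum_congr fun m =>
      lintegral_image_eq_lintegral_abs_det_fderiv_mul μ (hB m) (hBf' m) (hf.mono (hBs m)) g

theorem measurableSet_inter_preimage_of_continuousOn {X Y : Type*} [TopologicalSpace X]
    [MeasurableSpace X] [OpensMeasurableSpace X] [TopologicalSpace Y] [MeasurableSpace Y]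
    [BorelSpace Y] {f : X → Y} {s : Set X} {t : Set Y} (hf : ContinuousOn f s)
    (hs : MeasurableSet s) (ht : MeasurableSet t) : MeasurableSet (s ∩ f ⁻¹' t) := by
  rw [← Subtype.image_preimage_coe]
  exact (MeasurableEmbedding.subtype_coe hs).measurableSet_image.2
    (hf.domRestrict.measurable ht)

namespace HasWeakFDerivOn

variable {Ω : Set E}

theorem exists_lintegral_image_eq (h : HasWeakFDerivOn μ Ω f f') (hΩ : IsOpen Ω)
    (hf : InjOn f Ω) :
    ∃ S ⊆ Ω, MeasurableSet S ∧ S =ᵐ[μ] Ω ∧ ∀ s ⊆ S, MeasurableSet s →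
      MeasurableSet (f '' s) ∧ ∀ g : E → ℝ≥0∞,
        ∫⁻ y in f '' s, g y ∂μ = ∫⁻ x in s, ENNReal.ofReal |(f' x).det| * g (f x) ∂μ := by
  obtain ⟨A, hA, hAΩ, hAae, hAf'⟩ := h.exists_cover_hasFDerivWithinAt hΩ
  have hSΩ : ⋃ m, A m ⊆ Ω := iUnion_subset hAΩ
  exact ⟨⋃ m, A m, hSΩ, MeasurableSet.iUnion hA, hSΩ.eventuallyLE.antisymm hAae,
    fun s hsA hs => measurableSet_image_and_lintegral_image_eq_of_cover hA hAf' hs hsA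
      (hf.mono (hsA.trans hSΩ))⟩

theorem forall_setLIntegral_preimage_le_iff (h : HasWeakFDerivOn μ Ω f f') (hΩ : IsOpen Ω)
    (hfc : ContinuousOn f Ω) (hf : InjOn f Ω) {T : Set E} (hT : MapsTo f Ω T)
    {F k : E → ℝ≥0∞} (hF : AEMeasurable F (μ.restrict Ω)) :
    (∀ A, MeasurableSet A → A ⊆ T → ∫⁻ x in Ω ∩ f ⁻¹' A, F x ∂μ ≤ ∫⁻ y in A, k y ∂μ) ↔
      ∀ᵐ x ∂μ.restrict Ω, F x ≤ ENNReal.ofReal |(f' x).det| * k (f x) := by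
  obtain ⟨S, hSΩ, hS, hSae, harea⟩ := h.exists_lintegral_image_eq hΩ hf
  constructor
  · intro hle
    rw [← Measure.restrict_congr_set hSae] at hF ⊢
    refine ae_le_of_forall_setLIntegral_le_of_sigmaFinite₀ hF fun s hs _ => ?_
    have hsS : s ∩ S ⊆ S := inter_subset_right
    have hfs := harea (s ∩ S) hsS (hs.inter hS)
    have hle' := hle _ hfs.1 (hT.mono_left (hsS.trans hSΩ)).image_subset
    rwa [inter_comm, hf.preimage_image_inter (hsS.trans hSΩ), hfs.2 k,
      ← Measure.restrict_restrict hs] at hle'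
  · intro hle A hA _
    have hSA : MeasurableSet (S ∩ f ⁻¹' A) :=
      measurableSet_inter_preimage_of_continuousOn (hfc.mono hSΩ) hS hA
    calc ∫⁻ x in Ω ∩ f ⁻¹' A, F x ∂μ
        = ∫⁻ x in S ∩ f ⁻¹' A, F x ∂μ :=
          setLIntegral_congr (hSae.symm.inter Filter.EventuallyEq.rfl)
      _ ≤ ∫⁻ x in S ∩ f ⁻¹' A, ENNReal.ofReal |(f' x).det| * k (f x) ∂μ :=
          lintegral_mono_ae (ae_restrict_of_ae_restrict_of_subset
            (inter_subset_left.trans hSΩ) hle)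
      _ = ∫⁻ y in f '' (S ∩ f ⁻¹' A), k y ∂μ := ((harea _ inter_subset_left hSA).2 k).symm
      _ ≤ ∫⁻ y in A, k y ∂μ :=
          lintegral_mono_set ((image_mono inter_subset_right).trans (image_preimage_subset f A))

theorem exists_map_withDensity_det_eq (h : HasWeakFDerivOn μ Ω f f') (hΩ : IsOpen Ω)
    (hfc : ContinuousOn f Ω) (hf : InjOn f Ω) :
    ∃ P ⊆ {x ∈ Ω | (f' x).det ≠ 0}, MeasurableSet P ∧ P =ᵐ[μ] {x ∈ Ω | (f' x).det ≠ 0} ∧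
      MeasurableSet (f '' P) ∧
      ((μ.restrict P).withDensity fun x => ENNReal.ofReal |(f' x).det|).map f =
        μ.restrict (f '' P) := by
  obtain ⟨S, hSΩ, hS, hSae, harea⟩ := h.exists_lintegral_image_eq hΩ hf
  have hnull : NullMeasurableSet (S ∩ {x | (f' x).det ≠ 0}) μ := by
    simp only [← abs_pos (a := ContinuousLinearMap.det _)]
    rw [inter_comm, ← nullMeasurableSet_restrict hS.nullMeasurableSet]
    exact (h.aemeasurable_abs_det.mono_set hSΩ).nullMeasurableSet_preimage measurableSet_Ioi
  obtain ⟨P, hPS, hP, hPae⟩ := hnull.exists_measurable_subset_ae_eq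
  have hPΩ : P ⊆ Ω := hPS.trans (inter_subset_left.trans hSΩ)
  refine ⟨P, hPS.trans (inter_subset_inter_left _ hSΩ), hP,
    hPae.trans (hSae.inter Filter.EventuallyEq.rfl),
    (harea P (hPS.trans inter_subset_left) hP).1, ?_⟩
  have hfP : AEMeasurable f ((μ.restrict P).withDensity fun x => ENNReal.ofReal |(f' x).det|) :=
    ((hfc.mono hPΩ).aemeasurable hP).mono_ac (withDensity_absolutelyContinuous _ _)
  ext A hA
  have hPA : MeasurableSet (P ∩ f ⁻¹' A) :=
    measurableSet_inter_preimage_of_continuousOn (hfc.mono hPΩ) hP hA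
  have hμ := (harea (P ∩ f ⁻¹' A)
    (inter_subset_left.trans (hPS.trans inter_subset_left)) hPA).2 1
  simp only [Pi.one_apply, setLIntegral_one, mul_one] at hμ
  rw [Measure.map_apply_of_aemeasurable hfP hA, withDensity_apply', Measure.restrict_restrict' hP,
    Measure.restrict_apply hA, inter_comm, ← hμ, image_inter_preimage, inter_comm]

end HasWeakFDerivOn

end AreaFormula

section ChangeOfVariables

section WithDensity

variable {α F : Type*} [MeasurableSpace α] {ν : Measure α} [NormedAddCommGroup F]
  [NormedSpace ℝ F] {w : α → ℝ} {p : ℝ≥0∞} {g : α → F}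

theorem absolutelyContinuous_withDensity_ofReal (hw : AEMeasurable w ν)
    (hw0 : ∀ᵐ x ∂ν, 0 < w x) : ν ≪ ν.withDensity fun x => ENNReal.ofReal (w x) :=
  withDensity_absolutelyContinuous' hw.ennreal_ofReal
    (hw0.mono fun _ hx => (ENNReal.ofReal_pos.2 hx).ne')

theorem eLpNorm_withDensity_ofReal (hw : AEMeasurable w ν) (hw0 : ∀ᵐ x ∂ν, 0 < w x) (hp : p ≠ 0)
    (hg : AEStronglyMeasurable g ν) :
    eLpNorm g p (ν.withDensity fun x => ENNReal.ofReal (w x)) =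
      eLpNorm (fun x => w x ^ p.toReal⁻¹ • g x) p ν := by
  rcases eq_or_ne p ∞ with rfl | hp'
  · simp only [ENNReal.toReal_top, inv_zero, Real.rpow_zero, one_smul, eLpNorm_exponent_top]
    exact (essSup_mono_measure (withDensity_absolutelyContinuous ν _)).antisymm
      (essSup_mono_measure (absolutelyContinuous_withDensity_ofReal hw hw0))
  · rw [eLpNorm_eq_lintegral_rpow_enorm_toReal hp hp',
      eLpNorm_eq_lintegral_rpow_enorm_toReal hp hp',
      lintegral_withDensity_eq_lintegral_mul₀ hw.ennreal_ofReal (hg.enorm.pow_const _)]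
    congr 1
    refine lintegral_congr_ae ?_
    filter_upwards [hw0] with x hx
    have hp0 : p.toReal ≠ 0 := ENNReal.toReal_ne_zero.2 ⟨hp, hp'⟩
    rw [Pi.mul_apply, enorm_smul, ENNReal.mul_rpow_of_nonneg _ _ ENNReal.toReal_nonneg,
      Real.enorm_rpow_of_nonneg hx.le (inv_nonneg.2 ENNReal.toReal_nonneg), ← ENNReal.rpow_mul,
      inv_mul_cancel₀ hp0, ENNReal.rpow_one, Real.enorm_of_nonneg hx.le]

theorem memLp_withDensity_ofReal_iff (hw : AEMeasurable w ν) (hw0 : ∀ᵐ x ∂ν, 0 < w x)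
    (hp : p ≠ 0) (hg : AEStronglyMeasurable g (ν.withDensity fun x => ENNReal.ofReal (w x))) :
    MemLp g p (ν.withDensity fun x => ENNReal.ofReal (w x)) ↔
      MemLp (fun x => w x ^ p.toReal⁻¹ • g x) p ν := by
  have hgν : AEStronglyMeasurable g ν :=
    hg.mono_ac (absolutelyContinuous_withDensity_ofReal hw hw0)
  rw [MemLp, MemLp, eLpNorm_withDensity_ofReal hw hw0 hp hgν, and_congr_left_iff]
  exact fun _ => iff_of_true hg ((hw.pow_const _).aestronglyMeasurable.smul hgν)

end WithDensity

theorem exists_stronglyMeasurable_comp_ae_eq {X Y Z : Type*} [TopologicalSpace X] [PolishSpace X]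
    [MeasurableSpace X] [BorelSpace X] [TopologicalSpace Y] [PolishSpace Y] [MeasurableSpace Y]
    [BorelSpace Y] [TopologicalSpace Z] [Nonempty Z] {ν : Measure X} {s : Set X} {f : X → Y}
    (hs : MeasurableSet s) (hfc : ContinuousOn f s) (hf : InjOn f s) {m : X → Z}
    (hm : AEStronglyMeasurable m (ν.restrict s)) :
    ∃ g : Y → Z, StronglyMeasurable g ∧ ∀ᵐ x ∂ν.restrict s, g (f x) = m x := by
  obtain ⟨g, hg, hgm⟩ := (hfc.measurableEmbedding hs hf).exists_stronglyMeasurable_extend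
    (hm.stronglyMeasurable_mk.comp_measurable measurable_subtype_coe) fun _ => ‹Nonempty Z›
  refine ⟨g, hg, ?_⟩
  filter_upwards [hm.ae_eq_mk, ae_restrict_mem hs] with x hx hxs
  rw [hx]
  exact congrFun hgm ⟨x, hxs⟩

theorem mul_rpow_eq_mul_of_eq_rpow_mul {a b c r t : ℝ} (ha : 0 ≤ a) (ht : t ≠ 0) (htr : t + r = 1)
    (hc : a ≠ 0 → c = a ^ r * b) : c * a ^ t = a * b := by
  rcases ha.eq_or_lt with rfl | ha
  · rw [Real.zero_rpow ht, mul_zero, zero_mul]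
  · rw [hc ha.ne', mul_right_comm, ← Real.rpow_add ha, add_comm, htr, Real.rpow_one]

namespace HasWeakFDerivOn

variable {E F : Type*} [NormedAddCommGroup E] [NormedSpace ℝ E] [FiniteDimensional ℝ E]
  [MeasurableSpace E] [BorelSpace E] {μ : Measure E} [μ.IsAddHaarMeasure]
  [NormedAddCommGroup F] [NormedSpace ℝ F]
  {f : E → E} {f' : E → E →L[ℝ] E} {Ω T : Set E} {p : ℝ≥0∞}

theorem exists_memLp_image_iff (h : HasWeakFDerivOn μ Ω f f') (hΩ : IsOpen Ω)
    (hfc : ContinuousOn f Ω) (hf : InjOn f Ω) (hp : p ≠ 0) :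
    ∃ P ⊆ {x ∈ Ω | (f' x).det ≠ 0}, MeasurableSet P ∧ MeasurableSet (f '' P) ∧
      (∀ᵐ x ∂μ.restrict Ω, (f' x).det ≠ 0 → x ∈ P) ∧
      ∀ g : E → F, AEStronglyMeasurable g (μ.restrict (f '' P)) →
        (MemLp g p (μ.restrict (f '' P)) ↔
          MemLp (fun x => |(f' x).det| ^ p.toReal⁻¹ • g (f x)) p (μ.restrict P)) := by
  obtain ⟨P, hPdet, hP, hPae, hfP, hmap⟩ := h.exists_map_withDensity_det_eq hΩ hfc hf
  refine ⟨P, hPdet, hP, hfP, (ae_restrict_iff' hΩ.measurableSet).2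
    (hPae.mem_iff.mono fun x hx hxΩ hdet => hx.2 ⟨hxΩ, hdet⟩), fun g hg => ?_⟩
  have hPΩ : P ⊆ Ω := hPdet.trans (sep_subset _ _)
  have hdet : AEMeasurable (fun x => |(f' x).det|) (μ.restrict P) :=
    h.aemeasurable_abs_det.mono_set hPΩ
  have hdet0 : ∀ᵐ x ∂μ.restrict P, 0 < |(f' x).det| :=
    (ae_restrict_mem hP).mono fun x hx => abs_pos.2 (hPdet hx).2
  have hfm : AEMeasurable f ((μ.restrict P).withDensity fun x => ENNReal.ofReal |(f' x).det|) :=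
    ((hfc.mono hPΩ).aemeasurable hP).mono_ac (withDensity_absolutelyContinuous _ _)
  rw [← hmap] at hg ⊢
  rw [memLp_map_measure_iff hg hfm]
  exact memLp_withDensity_ofReal_iff hdet hdet0 hp (hg.comp_aemeasurable hfm)

theorem exists_memLp_eq_rpow_det_smul_comp (h : HasWeakFDerivOn μ Ω f f') (hΩ : IsOpen Ω)
    (hfc : ContinuousOn f Ω) (hf : InjOn f Ω) (hT : MapsTo f Ω T) (hp : p ≠ 0) {K : E → F}
    (hK : MemLp K p (μ.restrict T)) :
    ∃ L : E → F, MemLp L p (μ.restrict Ω) ∧ ∀ᵐ x ∂μ.restrict Ω,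
      (f' x).det ≠ 0 → L x = |(f' x).det| ^ p.toReal⁻¹ • K (f x) := by
  obtain ⟨P, hPdet, hP, -, hPae, hiff⟩ := h.exists_memLp_image_iff (F := F) hΩ hfc hf hp
  have hPΩ : P ⊆ Ω := hPdet.trans (sep_subset _ _)
  have hKP : MemLp K p (μ.restrict (f '' P)) :=
    hK.mono_measure (Measure.restrict_mono_set μ (hT.mono_left hPΩ).image_subset)
  refine ⟨P.indicator fun x => |(f' x).det| ^ p.toReal⁻¹ • K (f x), ?_,
    hPae.mono fun x hx hdet => indicator_of_mem (hx hdet) _⟩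
  rw [memLp_indicator_iff_restrict hP, Measure.restrict_restrict_of_subset hPΩ]
  exact (hiff K hKP.1).1 hKP

theorem exists_memLp_rpow_det_smul_comp_eq (h : HasWeakFDerivOn μ Ω f f') (hΩ : IsOpen Ω)
    (hfc : ContinuousOn f Ω) (hf : InjOn f Ω) (hp : p ≠ 0) {L : E → F}
    (hL : MemLp L p (μ.restrict Ω)) :
    ∃ K : E → F, MemLp K p μ ∧ ∀ᵐ x ∂μ.restrict Ω,
      (f' x).det ≠ 0 → L x = |(f' x).det| ^ p.toReal⁻¹ • K (f x) := by
  obtain ⟨P, hPdet, hP, hfP, hPae, hiff⟩ := h.exists_memLp_image_iff (F := F) hΩ hfc hf hp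
  have hPΩ : P ⊆ Ω := hPdet.trans (sep_subset _ _)
  have hLP : MemLp L p (μ.restrict P) := hL.mono_measure (Measure.restrict_mono_set μ hPΩ)
  have hdet : AEMeasurable (fun x => (|(f' x).det| ^ p.toReal⁻¹)⁻¹) (μ.restrict P) :=
    ((h.aemeasurable_abs_det.mono_set hPΩ).pow_const _).inv
  obtain ⟨g, hg, hgL⟩ := exists_stronglyMeasurable_comp_ae_eq hP (hfc.mono hPΩ) (hf.mono hPΩ)
    (hdet.aestronglyMeasurable.smul hLP.1)
  have hLg : ∀ᵐ x ∂μ.restrict P, L x = |(f' x).det| ^ p.toReal⁻¹ • g (f x) := by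
    filter_upwards [hgL, ae_restrict_mem hP] with x hx hxP
    rw [hx, Pi.smul_apply',
      smul_inv_smul₀ (Real.rpow_pos_of_pos (abs_pos.2 (hPdet hxP).2) _).ne']
  refine ⟨(f '' P).indicator g, ?_, ?_⟩
  · rw [memLp_indicator_iff_restrict hfP, hiff g hg.aestronglyMeasurable]
    exact hLP.ae_eq hLg
  · filter_upwards [hPae, ae_restrict_of_ae ((ae_restrict_iff' hP).1 hLg)] with x hxP hxL hx
    rw [indicator_of_mem (mem_image_of_mem f (hxP hx)), hxL (hxP hx)]

theorem exists_setLIntegral_preimage_le_iff {G : Type*} [SeminormedAddCommGroup G]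
    (h : HasWeakFDerivOn μ Ω f f') (hΩ : IsOpen Ω) (hfc : ContinuousOn f Ω) (hf : InjOn f Ω)
    (hT : MapsTo f Ω T) (hp : p ≠ 0) {t : ℝ} (ht : t ≠ 0) (htp : t + p.toReal⁻¹ = 1)
    {D : E → G} (hD : AEMeasurable (fun x => ‖D x‖ₑ) (μ.restrict Ω)) :
    (∃ K : E → ℝ, (∀ y, 0 ≤ K y) ∧ MemLp K p (μ.restrict T) ∧
        ∀ A, MeasurableSet A → A ⊆ T →
          ∫⁻ x in Ω ∩ f ⁻¹' A, ‖D x‖ₑ ∂μ ≤ ∫⁻ y in A, ENNReal.ofReal (K y) ∂μ) ↔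
      ∃ L : E → ℝ, MemLp L p (μ.restrict Ω) ∧
        ∀ᵐ x ∂μ.restrict Ω, ‖D x‖ ≤ L x * |(f' x).det| ^ t := by
  have hpointwise {K : E → ℝ} (hK : ∀ y, 0 ≤ K y) :
      (∀ A, MeasurableSet A → A ⊆ T →
        ∫⁻ x in Ω ∩ f ⁻¹' A, ‖D x‖ₑ ∂μ ≤ ∫⁻ y in A, ENNReal.ofReal (K y) ∂μ) ↔
      ∀ᵐ x ∂μ.restrict Ω, ‖D x‖ ≤ |(f' x).det| * K (f x) := by
    rw [h.forall_setLIntegral_preimage_le_iff hΩ hfc hf hT hD]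
    refine Filter.eventually_congr (Filter.Eventually.of_forall fun x => ?_)
    rw [← ENNReal.ofReal_mul (abs_nonneg _), ← ofReal_norm,
      ENNReal.ofReal_le_ofReal_iff (mul_nonneg (abs_nonneg _) (hK _))]
  constructor
  · rintro ⟨K, hK0, hK, hDK⟩
    obtain ⟨L, hL, hLK⟩ := h.exists_memLp_eq_rpow_det_smul_comp hΩ hfc hf hT hp hK
    refine ⟨L, hL, ?_⟩
    filter_upwards [(hpointwise hK0).1 hDK, hLK] with x hx hxL
    rwa [mul_rpow_eq_mul_of_eq_rpow_mul (abs_nonneg _) ht htp fun hdet => hxL (abs_ne_zero.1 hdet)]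
  · rintro ⟨L, hL, hDL⟩
    obtain ⟨K, hK, hLK⟩ := h.exists_memLp_rpow_det_smul_comp_eq hΩ hfc hf hp hL
    refine ⟨fun y => |K y|, fun y => abs_nonneg _, (hK.restrict T).norm,
      (hpointwise fun y => abs_nonneg _).2 ?_⟩
    filter_upwards [hDL, hLK] with x hx hxL
    rw [mul_rpow_eq_mul_of_eq_rpow_mul (abs_nonneg _) ht htp
      fun hdet => hxL (abs_ne_zero.1 hdet)] at hx
    exact hx.trans (mul_le_mul_of_nonneg_left (le_abs_self _) (abs_nonneg _))

end HasWeakFDerivOn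

end ChangeOfVariables

theorem inv_toReal_add_inv_toReal_eq_one {p q : ℝ≥0∞} (h : ENNReal.HolderConjugate p q) :
    p.toReal⁻¹ + q.toReal⁻¹ = 1 := by
  have hp : p⁻¹ ≠ ⊤ := ENNReal.inv_ne_top.2 (ENNReal.HolderConjugate.ne_zero p q)
  have hq : q⁻¹ ≠ ⊤ := ENNReal.inv_ne_top.2 (ENNReal.HolderConjugate.ne_zero q p)
  rw [← ENNReal.toReal_inv, ← ENNReal.toReal_inv, ← ENNReal.toReal_add hp hq,
    ENNReal.HolderConjugate.inv_add_inv_eq_one p q, ENNReal.toReal_one]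

theorem mainTheorem4_general {n : ℕ} {Ω₁ Ω₂ : Set (Rn n)} (hΩ₁ : IsOpen Ω₁)
    {f : Rn n → Rn n} (hfc : ContinuousOn f Ω₁) (hf : InjOn f Ω₁) (hfΩ : MapsTo f Ω₁ Ω₂)
    {Df : Rn n → Matrix (Fin n) (Fin n) ℝ} (hDf : HasLocSobolevDeriv Ω₁ f Df)
    {q : ℝ} {q' : ℝ≥0∞} (hqq' : ENNReal.HolderConjugate (ENNReal.ofReal q) q') :
    (∃ K : Rn n → ℝ, (∀ y, 0 ≤ K y) ∧ MemLp K q' (volume.restrict Ω₂) ∧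
        ∀ A : Set (Rn n), MeasurableSet A → A ⊆ Ω₂ →
          totalVariation Ω₁ f (Ω₁ ∩ f ⁻¹' A) ≤ ∫⁻ y in A, ENNReal.ofReal (K y)) ↔
      (∃ L : Rn n → ℝ, MemLp L q' (volume.restrict Ω₁) ∧
        ∀ᵐ x ∂(volume.restrict Ω₁), ‖Df x‖ ≤ L x * |(Df x).det| ^ (1 / q)) := by
  have hq : 0 < q :=
    ENNReal.ofReal_pos.1 (pos_iff_ne_zero.2 (ENNReal.HolderConjugate.ne_zero _ q'))
  have hexp : 1 / q + q'.toReal⁻¹ = 1 := by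
    simpa only [ENNReal.toReal_ofReal hq.le, one_div] using inv_toReal_add_inv_toReal_eq_one hqq'
  have hvar {A : Set (Rn n)} (hA : MeasurableSet A) :
      totalVariation Ω₁ f (Ω₁ ∩ f ⁻¹' A) = ∫⁻ x in Ω₁ ∩ f ⁻¹' A, ‖Df x‖ₑ :=
    hDf.totalVariation_eq hΩ₁
      (measurableSet_inter_preimage_of_continuousOn hfc hΩ₁.measurableSet hA) inter_subset_left
  have hnorm : AEMeasurable (fun x => ‖Df x‖ₑ) (volume.restrict Ω₁) := by
    simpa only [enorm_matrixVec] using hDf.locallyIntegrableOn_matrixVec.aestronglyMeasurable.enorm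
  have hiff := hDf.hasWeakFDerivOn.exists_setLIntegral_preimage_le_iff hΩ₁ hfc hf hfΩ
    (ENNReal.HolderConjugate.ne_zero q' (.ofReal q)) (one_div_ne_zero hq.ne') hexp hnorm
  simp only [det_matrixCLM] at hiff
  rw [← hiff]
  simp +contextual only [hvar]

theorem mainTheorem4 (n : ℕ) (Ω₁ Ω₂ : Set (Rn n))
    (f : OpenPartialHomeomorph (Rn n) (Rn n)) (hsource : f.source = Ω₁) (htarget : f.target = Ω₂)
    (Df : Rn n → Matrix (Fin n) (Fin n) ℝ) (hDf : HasLocSobolevDeriv Ω₁ f Df)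
    (q : ℝ) (hq : 1 ≤ q) (q' : ℝ≥0∞) (hqq' : ENNReal.HolderConjugate (ENNReal.ofReal q) q') :
    (∃ K : Rn n → ℝ, (∀ y, 0 ≤ K y) ∧ MemLp K q' (volume.restrict Ω₂) ∧
        ∀ A : Set (Rn n), MeasurableSet A → A ⊆ Ω₂ →
          totalVariation Ω₁ f (Ω₁ ∩ f ⁻¹' A) ≤ ∫⁻ y in A, ENNReal.ofReal (K y)) ↔
      (∃ L : Rn n → ℝ, MemLp L q' (volume.restrict Ω₁) ∧
        ∀ᵐ x ∂(volume.restrict Ω₁), ‖Df x‖ ≤ L x * |(Df x).det| ^ (1 / q)) := by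
  subst hsource htarget
  exact mainTheorem4_general f.open_source f.continuousOn f.injOn f.mapsTo hDf hqq'
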